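/- Let $H$ be a finite-dimensional Hopf algebra over an algebraically closed field $\Bbbk$ of characteristic $p>0$, and let $x\in H$ be a nonzero primitive element, i.e. $\Delta(x)=x\otimes 1+1\otimes x$. Let $\Bbbk[x]$ denote the subalgebra of $H$ generated by $x$; it satisfies $\Delta(\Bbbk[x])\subseteq \Bbbk[x]\otimes\Bbbk[x]$. Let $C=\sum_i C_i$ be a sum of simple subcoalgebras $C_i$ of $H$. (i) If $xC\subseteq C$, then every simple right $C$-comodule $M$ admits a left $\Bbbk[x]$-module structure that makes $M$ a Hopf module in ${}_{\Bbbk[x]}\mathcal{M}^{H}$; that is, if $\rho(m)=\sum m_0\otimes m_1\in M\otimes H$ is the coaction of $C$ on $M$ regarded as a right $H$-coaction, then $\rho(u m)=\sum u_1 m_0\otimes u_2 m_1$ for all $u\in\Bbbk[x]$ and $m\in M$. In particular, $M$ is finite-dimensional and $\dim \Bbbk[x]$ divides $\dim M$, and hence $(\dim \Bbbk[x])^2$ divides $\dim C_i$ for every $i$. (ii) If $C$ is simple and $p\nmid\dim C$, then $\Bbbk[x]\,C$, the left $\Bbbk[x]$-submodule of $H$ generated by $C$, is a free left $\Bbbk[x]$-module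 of rank $\dim C$. -/

import Mathlib

open scoped TensorProduct

noncomputable section

section Subcoalgebras

variable {k : Type*} [Field k] {H : Type*} [AddCommGroup H] [Module k H] [Coalgebra k H]

/-- A subspace `C` of a coalgebra with `Δ(C) ⊆ C ⊗ C`, where `C ⊗ C` is regarded as a subspace
of `H ⊗ H`. -/
def IsSubcoalgebra (C : Submodule k H) : Prop :=
  ∀ c ∈ C, Coalgebra.comul (R := k) c ∈ LinearMap.range (TensorProduct.map C.subtype C.subtype)

variable (k H) in
/-- Subcoalgebras of a coalgebra. -/
structure Subcoalgebra extends Submodule k H where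
  isSubcoalgebra : IsSubcoalgebra toSubmodule

namespace Subcoalgebra

instance : SetLike (Subcoalgebra k H) H where
  coe C := C.carrier
  coe_injective C D h := by
    cases C; cases D
    congr
    exact SetLike.coe_injective h

instance (C : Subcoalgebra k H) : AddCommGroup C :=
  inferInstanceAs (AddCommGroup C.toSubmodule)

instance (C : Subcoalgebra k H) : Module k C :=
  inferInstanceAs (Module k C.toSubmodule)

/-- The inclusion of a subcoalgebra, as a linear map. -/
def subtype (C : Subcoalgebra k H) : C →ₗ[k] H := C.toSubmodule.subtype

theorem subtype_injective (C : Subcoalgebra k H) : Function.Injective C.subtype :=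
  C.toSubmodule.injective_subtype

theorem map_subtype_injective (C : Subcoalgebra k H) :
    Function.Injective (TensorProduct.map C.subtype C.subtype) :=
  TensorProduct.map_injective_of_flat_flat _ _ C.subtype_injective C.subtype_injective

theorem exists_comul (C : Subcoalgebra k H) :
    ∃ d : C →ₗ[k] C ⊗[k] C,
      TensorProduct.map C.subtype C.subtype ∘ₗ d = Coalgebra.comul ∘ₗ C.subtype := by
  let e := LinearEquiv.ofInjective (TensorProduct.map C.subtype C.subtype) C.map_subtype_injective
  refine ⟨e.symm.toLinearMap ∘ₗ (Coalgebra.comul ∘ₗ C.subtype).codRestrict _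
    (fun c => C.isSubcoalgebra c c.2), ?_⟩
  ext c
  exact congrArg Subtype.val (e.apply_symm_apply _)

/-- The coalgebra structure of a subcoalgebra: the comultiplication is the unique map that the
inclusion intertwines with the comultiplication of the ambient coalgebra, and the counit is the
restriction. -/
instance (C : Subcoalgebra k H) : CoalgebraStruct k C where
  comul := C.exists_comul.choose
  counit := Coalgebra.counit ∘ₗ C.subtype

theorem map_comp_comul (C : Subcoalgebra k H) :
    TensorProduct.map C.subtype C.subtype ∘ₗ CoalgebraStruct.comul =
      CoalgebraStruct.comul ∘ₗ C.subtype :=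
  C.exists_comul.choose_spec

theorem counit_eq (C : Subcoalgebra k H) :
    (CoalgebraStruct.counit : C →ₗ[k] k) = CoalgebraStruct.counit ∘ₗ C.subtype := rfl

instance (C : Subcoalgebra k H) : Coalgebra k C where
  coassoc := by
    have inj : Function.Injective
        (TensorProduct.map C.subtype (TensorProduct.map C.subtype C.subtype)) :=
      TensorProduct.map_injective_of_flat_flat _ _ C.subtype_injective C.map_subtype_injective
    rw [← LinearMap.cancel_left inj]
    have h1 : TensorProduct.map C.subtype (TensorProduct.map C.subtype C.subtype) ∘ₗ
        (TensorProduct.assoc k C C C).toLinearMap =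
        (TensorProduct.assoc k H H H).toLinearMap ∘ₗ
          TensorProduct.map (TensorProduct.map C.subtype C.subtype) C.subtype := by
      ext; rfl
    calc _ = (TensorProduct.assoc k H H H).toLinearMap ∘ₗ
            CoalgebraStruct.comul.rTensor H ∘ₗ CoalgebraStruct.comul ∘ₗ C.subtype := by
          rw [← LinearMap.comp_assoc, h1, LinearMap.comp_assoc, ← C.map_comp_comul]
          congr 1
          rw [← LinearMap.comp_assoc, ← LinearMap.comp_assoc, LinearMap.rTensor_comp_map,
            LinearMap.map_comp_rTensor, C.map_comp_comul]
      _ = CoalgebraStruct.comul.lTensor H ∘ₗ CoalgebraStruct.comul ∘ₗ C.subtype := by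
          have := Coalgebra.coassoc (R := k) (A := H)
          simp only [← LinearMap.comp_assoc] at this ⊢
          rw [this]
      _ = _ := by
          rw [← C.map_comp_comul, ← LinearMap.comp_assoc, ← LinearMap.comp_assoc,
            LinearMap.lTensor_comp_map, LinearMap.map_comp_lTensor, C.map_comp_comul]
  rTensor_counit_comp_comul := by
    have inj : Function.Injective (C.subtype.lTensor k) :=
      Module.Flat.lTensor_preserves_injective_linearMap _ C.subtype_injective
    rw [← LinearMap.cancel_left inj, ← LinearMap.comp_assoc, counit_eq]
    calc _ = CoalgebraStruct.counit.rTensor H ∘ₗ CoalgebraStruct.comul ∘ₗ C.subtype := by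
          rw [← C.map_comp_comul, ← LinearMap.comp_assoc, LinearMap.lTensor_comp_rTensor,
            LinearMap.rTensor_comp_map]
      _ = _ := by
          rw [← LinearMap.comp_assoc, Coalgebra.rTensor_counit_comp_comul]
          ext; rfl
  lTensor_counit_comp_comul := by
    have inj : Function.Injective (C.subtype.rTensor k) :=
      Module.Flat.rTensor_preserves_injective_linearMap _ C.subtype_injective
    rw [← LinearMap.cancel_left inj, ← LinearMap.comp_assoc, counit_eq]
    calc _ = CoalgebraStruct.counit.lTensor H ∘ₗ CoalgebraStruct.comul ∘ₗ C.subtype := by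
          rw [← C.map_comp_comul, ← LinearMap.comp_assoc, LinearMap.rTensor_comp_lTensor,
            LinearMap.lTensor_comp_map]
      _ = _ := by
          rw [← LinearMap.comp_assoc, Coalgebra.lTensor_counit_comp_comul]
          ext; rfl

/-- The inclusion of a subcoalgebra, as a coalgebra homomorphism. -/
def incl (C : Subcoalgebra k H) : C →ₗc[k] H where
  toLinearMap := C.subtype
  counit_comp := rfl
  map_comp_comul := C.map_comp_comul

/-- A simple subcoalgebra: nonzero, with no subcoalgebras other than `0` and itself. -/
def IsSimple (C : Subcoalgebra k H) : Prop :=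
  C.toSubmodule ≠ ⊥ ∧
    ∀ D : Subcoalgebra k H, D.toSubmodule ≤ C.toSubmodule →
      D.toSubmodule = ⊥ ∨ D.toSubmodule = C.toSubmodule

end Subcoalgebra

end Subcoalgebras

section Comodules

variable {k : Type*} [Field k]

/-- A right `C`-comodule structure on a vector space `M`. -/
structure RightComodule (k C M : Type*) [Field k] [AddCommGroup C] [Module k C] [Coalgebra k C]
    [AddCommGroup M] [Module k M] where
  /-- The coaction `ρ : M → M ⊗ C`. -/
  coact : M →ₗ[k] M ⊗[k] C
  /-- `(ρ ⊗ id) ρ = (id ⊗ Δ) ρ` -/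
  coassoc : (TensorProduct.assoc k M C C).toLinearMap ∘ₗ coact.rTensor C ∘ₗ coact =
    Coalgebra.comul.lTensor M ∘ₗ coact
  /-- `(id ⊗ ε) ρ = id` -/
  counit_coact : Coalgebra.counit.lTensor M ∘ₗ coact = (TensorProduct.mk k M k).flip 1

namespace RightComodule

variable {C D M : Type*} [AddCommGroup C] [Module k C] [Coalgebra k C]
  [AddCommGroup D] [Module k D] [Coalgebra k D] [AddCommGroup M] [Module k M]

/-- A subspace `N` with `ρ(N) ⊆ N ⊗ C`. -/
def IsSubcomodule (ρ : RightComodule k C M) (N : Submodule k M) : Prop :=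
  ∀ m ∈ N, ρ.coact m ∈ LinearMap.range (N.subtype.rTensor C)

/-- A simple comodule: nonzero, with no subcomodules other than `0` and itself. -/
def IsSimple (ρ : RightComodule k C M) : Prop :=
  Nontrivial M ∧ ∀ N : Submodule k M, ρ.IsSubcomodule N → N = ⊥ ∨ N = ⊤

/-- The right `D`-comodule `(id ⊗ f) ρ` obtained from a right `C`-comodule and a coalgebra
homomorphism `f : C → D`. -/
def push (ρ : RightComodule k C M) (f : C →ₗc[k] D) : RightComodule k D M where
  coact := f.toLinearMap.lTensor M ∘ₗ ρ.coact
  coassoc := by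
    have h1 : (TensorProduct.assoc k M D D).toLinearMap ∘ₗ
        TensorProduct.map (f.toLinearMap.lTensor M) f.toLinearMap =
        (TensorProduct.map f.toLinearMap f.toLinearMap).lTensor M ∘ₗ
          (TensorProduct.assoc k M C C).toLinearMap := by
      ext; rfl
    calc _ = ((TensorProduct.assoc k M D D).toLinearMap ∘ₗ
            TensorProduct.map (f.toLinearMap.lTensor M) f.toLinearMap) ∘ₗ
            ρ.coact.rTensor C ∘ₗ ρ.coact := by
          simp only [← LinearMap.comp_assoc]
          congr 1
          simp only [LinearMap.comp_assoc]
          congr 1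
          rw [LinearMap.rTensor_comp_lTensor, LinearMap.map_comp_rTensor]
      _ = (TensorProduct.map f.toLinearMap f.toLinearMap).lTensor M ∘ₗ
            Coalgebra.comul.lTensor M ∘ₗ ρ.coact := by
          rw [h1, LinearMap.comp_assoc, ρ.coassoc]
      _ = _ := by
          rw [← LinearMap.comp_assoc, ← LinearMap.comp_assoc, ← LinearMap.lTensor_comp,
            ← LinearMap.lTensor_comp, f.map_comp_comul]
  counit_coact := by
    rw [← LinearMap.comp_assoc, ← LinearMap.lTensor_comp, f.counit_comp, ρ.counit_coact]

end RightComodule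

end Comodules

section HopfModules

variable {k : Type*} [Field k] {H : Type*} [Ring H] [Bialgebra k H]

variable (k) in
/-- Primitive elements: `Δ(x) = x ⊗ 1 + 1 ⊗ x`. -/
def IsPrimitiveElement (x : H) : Prop :=
  Coalgebra.comul (R := k) x = x ⊗ₜ[k] (1 : H) + (1 : H) ⊗ₜ[k] x

/-- A subalgebra `K` of a bialgebra with `Δ(K) ⊆ K ⊗ K`. -/
def IsSubbialgebra (K : Subalgebra k H) : Prop :=
  ∀ u ∈ K, Coalgebra.comul (R := k) u ∈ (Algebra.TensorProduct.map K.val K.val).range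

namespace IsSubbialgebra

variable {K : Subalgebra k H}

theorem map_val_injective (K : Subalgebra k H) :
    Function.Injective (Algebra.TensorProduct.map K.val K.val) :=
  TensorProduct.map_injective_of_flat_flat K.val.toLinearMap K.val.toLinearMap
    Subtype.val_injective Subtype.val_injective

/-- The comultiplication `K → K ⊗ K` that a subbialgebra inherits. -/
def comul (hK : IsSubbialgebra K) : K →ₐ[k] K ⊗[k] K :=
  (AlgEquiv.ofInjective _ (map_val_injective K)).symm.toAlgHom.comp
    (((Bialgebra.comulAlgHom k H).comp K.val).codRestrict _ (fun u => hK u u.2))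

theorem map_comul (hK : IsSubbialgebra K) (u : K) :
    Algebra.TensorProduct.map K.val K.val (hK.comul u) = Coalgebra.comul (R := k) (u : H) :=
  congrArg Subtype.val ((AlgEquiv.ofInjective _ (map_val_injective K)).apply_symm_apply
    ⟨Coalgebra.comul (R := k) (u : H), hK u u.2⟩)

end IsSubbialgebra

/-- The subalgebra `k[x]` generated by a primitive element `x` is a subbialgebra. -/
theorem IsPrimitiveElement.isSubbialgebra_adjoin {x : H} (hx : IsPrimitiveElement k x) :
    IsSubbialgebra (Algebra.adjoin k {x}) := by
  have h : Algebra.adjoin k {x} ≤ (Algebra.TensorProduct.map (Algebra.adjoin k {x}).val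
      (Algebra.adjoin k {x}).val).range.comap (Bialgebra.comulAlgHom k H) := by
    rw [Algebra.adjoin_le_iff, Set.singleton_subset_iff]
    let y : Algebra.adjoin k {x} := ⟨x, Algebra.self_mem_adjoin_singleton k x⟩
    refine ⟨y ⊗ₜ 1 + 1 ⊗ₜ y, ?_⟩
    simp only [RingHom.coe_coe, map_add]
    exact hx.symm
  exact fun u hu => h hu

section

variable {M : Type*} [AddCommGroup M] [Module k M]

/-- The action of `K ⊗ K` on `M ⊗ H` with `(u ⊗ v)(m ⊗ h) = u m ⊗ v h`, for a left action `act`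
of `K` on `M`. -/
def tensorAct {K : Subalgebra k H} (act : K →ₐ[k] Module.End k M) :
    K ⊗[k] K →ₗ[k] Module.End k (M ⊗[k] H) :=
  TensorProduct.homTensorHomMap (RingHom.id k) M H M H ∘ₗ
    TensorProduct.map act.toLinearMap ((Algebra.lmul k H).comp K.val).toLinearMap

/-- `M`, with a left `K`-action and a right `H`-coaction `ρ`, is a Hopf module in the category of
left `K`-modules and right `H`-comodules: `ρ(u m) = u₁ m₀ ⊗ u₂ m₁`. -/
def IsHopfModule {K : Subalgebra k H} (hK : IsSubbialgebra K) (act : K →ₐ[k] Module.End k M)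
    (ρ : RightComodule k H M) : Prop :=
  ∀ (u : K) (m : M), ρ.coact (act u m) = tensorAct act (hK.comul u) (ρ.coact m)

end

end HopfModules

end

/-! Write `P` for the minimal polynomial of `x` and `d` for its degree, so that `d = dim k[x]`.
Comparing coefficients in `Δ(P(x)) = 0` shows that `P` is additive: `P(a + b) = P(a) + P(b)` for
commuting `a`, `b`. In particular `p ∣ d` when `x ≠ 0`.

Hopf module structure. If `x` preserves a sum of simple subcoalgebras, it preserves each
subcoalgebra inside it, in particular the coefficient coalgebra of a simple comodule `M`. By
Burnside the dual of that coalgebra is `End M`, and left multiplication by `x` induces a derivation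
of `End M`. This derivation is inner, which gives `A` with `ρ(A m) = (A ⊗ 1 + 1 ⊗ x) ρ(m)`. Then
`P(A)` commutes with the dual action, so it is a scalar, and translating `A` by a scalar makes it
zero. Thus `x ↦ A` extends to `k[x]` (`IsIrreducible.exists_aeval_eq_zero`).

Divisibility. The automorphism `m ⊗ h ↦ m₀ ⊗ m₁ h` of `M ⊗ H` turns `A ⊗ 1` into `A ⊗ 1 + 1 ⊗ x`, so
for every polynomial `Q` the rank of `Q(A ⊗ 1 + 1 ⊗ x)` is `rank Q(A) · dim H`. Take `Q = P / (X -
g)` for a root `g` minimizing `r = rank Q(x)` on `H`. The case `M = H` forces `H` to be free of rank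
`r` over `k[x]`. For general `M` the same rank is also `r · dim M`, hence `dim M = d · rank Q(A)`
(`natDegree_dvd_finrank`). The coefficients of a simple comodule span a space of dimension `(dim
M)²`, which gives the divisibility of `dim Cᵢ`.

Freeness. Suppose the sum of the `xⁱ C`, `i < m`, is direct with `m < d`. The `c ∈ C` with `xᵐ c` in
this sum form a subcoalgebra, hence `0` or `C`. If it is `C`, write `xᵐ c = ∑ xⁱ θᵢ(c)`. Applying
`Δ` shows that each `θᵢ` with `i > 0` is a bicomodule endomorphism, hence a scalar `lᵢ`, and that `R
= Xᵐ - ∑_{0 < i < m} lᵢ Xⁱ` is additive. So `R(x)` is a nonzero primitive element with `R(x) C ⊆ C`,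
and the first half applied to it yields `p ∣ dim C`
(`IsPrimitiveElement.eq_zero_of_pow_mul_mem_powSpan`). -/

open Polynomial

/-! ### Additive polynomials -/

section AdditivePolynomials

variable {k : Type*} [Field k]

/-- Polynomials `P` with `P(X + Y) = P(X) + P(Y)`, expressed through the coefficients. -/
structure Polynomial.IsAdditive (P : k[X]) : Prop where
  coeff_zero : P.coeff 0 = 0
  coeff_mul_choose : ∀ i j, 0 < i → 0 < j → P.coeff (i + j) * ((i + j).choose i : k) = 0

namespace Polynomial.IsAdditive

variable {P : k[X]} {A : Type*} [Ring A] [Algebra k A]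

/-- Additivity kills every mixed term of the binomial expansion. The exponent `0` is separate: there
both sides vanish because the constant coefficient does. -/
theorem coeff_smul_add_pow (hP : P.IsAdditive) {a b : A} (h : Commute a b) (n : ℕ) :
    P.coeff n • (a + b) ^ n = P.coeff n • a ^ n + P.coeff n • b ^ n := by
  rcases n with _ | n
  · simp [hP.coeff_zero]
  rw [h.add_pow, Finset.sum_range_succ, Finset.sum_range_succ', smul_add, smul_add,
    Finset.smul_sum, Finset.sum_eq_zero, zero_add, add_comm]
  · simp
  · intro m hm
    have hm' := Finset.mem_range.mp hm
    have := hP.coeff_mul_choose (m + 1) (n - m) (by omega) (by omega)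
    rw [show m + 1 + (n - m) = n + 1 by omega] at this
    rw [← nsmul_eq_mul', ← Nat.cast_smul_eq_nsmul k, smul_smul, this, zero_smul]

theorem aeval_add (hP : P.IsAdditive) {a b : A} (h : Commute a b) :
    aeval (a + b) P = aeval a P + aeval b P := by
  simp only [aeval_eq_sum_range, ← Finset.sum_add_distrib]
  exact Finset.sum_congr rfl fun n _ => hP.coeff_smul_add_pow h n

end Polynomial.IsAdditive

end AdditivePolynomials

/-! ### Ranks of polynomials in `A ⊗ 1 + 1 ⊗ B` -/

section TensorSum

variable {k : Type*} [Field k] {V W V' W' V'' W'' : Type*}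
  [AddCommGroup V] [Module k V] [AddCommGroup W] [Module k W]
  [AddCommGroup V'] [Module k V'] [AddCommGroup W'] [Module k W']
  [AddCommGroup V''] [Module k V''] [AddCommGroup W''] [Module k W'']

/-- The endomorphism `A ⊗ 1 + 1 ⊗ B` of `V ⊗ W`. -/
noncomputable def tensorSum (A : Module.End k V) (B : Module.End k W) : Module.End k (V ⊗[k] W) :=
  A.rTensor W + B.lTensor V

theorem tensorSum_tmul (A : Module.End k V) (B : Module.End k W) (v : V) (w : W) :
    tensorSum A B (v ⊗ₜ w) = A v ⊗ₜ w + v ⊗ₜ B w := rfl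

theorem commute_rTensor_lTensor (A : Module.End k V) (B : Module.End k W) :
    Commute (A.rTensor W : Module.End k (V ⊗[k] W)) (B.lTensor V) :=
  (LinearMap.rTensor_comp_lTensor ..).trans (LinearMap.lTensor_comp_rTensor ..).symm

theorem tensorSum_pow (A : Module.End k V) (B : Module.End k W) (n : ℕ) :
    tensorSum A B ^ n =
      ∑ m ∈ Finset.range (n + 1), (n.choose m : k) • TensorProduct.map (A ^ m) (B ^ (n - m)) := by
  rw [tensorSum, (commute_rTensor_lTensor A B).add_pow]
  refine Finset.sum_congr rfl fun m _ => ?_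
  rw [← nsmul_eq_mul', ← Nat.cast_smul_eq_nsmul k, LinearMap.rTensor_pow, LinearMap.lTensor_pow]
  congr 1
  exact LinearMap.rTensor_comp_lTensor ..

theorem aeval_rTensor (A : Module.End k V) (P : k[X]) :
    aeval (A.rTensor W : Module.End k (V ⊗[k] W)) P = (aeval A P).rTensor W := by
  simp only [aeval_eq_sum_range, LinearMap.rTensor_pow]
  ext v w
  simp [LinearMap.sum_apply, TensorProduct.sum_tmul, TensorProduct.smul_tmul']

theorem aeval_lTensor (B : Module.End k W) (P : k[X]) :
    aeval (B.lTensor V : Module.End k (V ⊗[k] W)) P = (aeval B P).lTensor V := by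
  simp only [aeval_eq_sum_range, LinearMap.lTensor_pow]
  ext v w
  simp [LinearMap.sum_apply, TensorProduct.tmul_sum]

theorem Polynomial.IsAdditive.aeval_tensorSum {P : k[X]} (hP : P.IsAdditive)
    {A : Module.End k V} {B : Module.End k W} (hA : aeval A P = 0) (hB : aeval B P = 0) :
    aeval (tensorSum A B) P = 0 := by
  rw [tensorSum, hP.aeval_add (commute_rTensor_lTensor A B), aeval_rTensor, aeval_lTensor, hA, hB]
  simp

/-- The expansion into pure tensors of maps, in which a term dies as soon as one of its two factors
does. -/
theorem map_comp_aeval_tensorSum_comp_map (A : Module.End k V) (B : Module.End k W)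
    (σ : V' →ₗ[k] V) (φ : W' →ₗ[k] W) (q : V →ₗ[k] V'') (π : W →ₗ[k] W'') (Q : k[X]) :
    TensorProduct.map q π ∘ₗ aeval (tensorSum A B) Q ∘ₗ TensorProduct.map σ φ =
      ∑ n ∈ Finset.range (Q.natDegree + 1), Q.coeff n • ∑ m ∈ Finset.range (n + 1),
        (n.choose m : k) • TensorProduct.map (q ∘ₗ (A ^ m) ∘ₗ σ) (π ∘ₗ (B ^ (n - m)) ∘ₗ φ) := by
  ext v w
  simp [aeval_eq_sum_range, tensorSum_pow, LinearMap.sum_apply, map_sum]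

/-- Maps `φ : N → W` and `π : W → N` with `π Bⁱ φ = 0` for `i < e` and `π Bᵉ φ = id`. -/
structure IsTopPairing {N : Type*} [AddCommGroup N] [Module k N] (B : Module.End k W) (e : ℕ)
    (φ : N →ₗ[k] W) (π : W →ₗ[k] N) : Prop where
  lt : ∀ i < e, π ∘ₗ (B ^ i) ∘ₗ φ = 0
  top : π ∘ₗ (B ^ e) ∘ₗ φ = LinearMap.id

variable {N : Type*} [AddCommGroup N] [Module k N]

/-- The exponent of `B` reaches `Q.natDegree` only in the term `n = Q.natDegree`, `m = 0`, whose
coefficient is `1`. The pairing annihilates all lower exponents. -/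
theorem IsTopPairing.compress_right {A : Module.End k V} {B : Module.End k W} {Q : k[X]}
    (hQ : Q.Monic) {φ : N →ₗ[k] W} {π : W →ₗ[k] N} (h : IsTopPairing B Q.natDegree φ π)
    (σ : V' →ₗ[k] V) (q : V →ₗ[k] V'') :
    TensorProduct.map q π ∘ₗ aeval (tensorSum A B) Q ∘ₗ TensorProduct.map σ φ =
      TensorProduct.map (q ∘ₗ σ) LinearMap.id := by
  rw [map_comp_aeval_tensorSum_comp_map, Finset.sum_range_succ, Finset.sum_eq_zero, zero_add,
    hQ.coeff_natDegree, one_smul, Finset.sum_range_succ', Finset.sum_eq_zero, zero_add]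
  · simp [h.top]; rfl
  · intro m hm
    rw [h.lt _ (by have := Finset.mem_range.mp hm; omega), TensorProduct.map_zero_right, smul_zero]
  · intro n hn
    rw [Finset.sum_eq_zero, smul_zero]
    intro m hm
    rw [h.lt _ (by have := Finset.mem_range.mp hn; omega), TensorProduct.map_zero_right, smul_zero]

theorem IsTopPairing.compress_left {A : Module.End k V} {B : Module.End k W} {Q : k[X]}
    (hQ : Q.Monic) {φ : N →ₗ[k] V} {π : V →ₗ[k] N} (h : IsTopPairing A Q.natDegree φ π)
    (σ : W' →ₗ[k] W) (q : W →ₗ[k] W'') :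
    TensorProduct.map π q ∘ₗ aeval (tensorSum A B) Q ∘ₗ TensorProduct.map φ σ =
      TensorProduct.map LinearMap.id (q ∘ₗ σ) := by
  rw [map_comp_aeval_tensorSum_comp_map, Finset.sum_range_succ, Finset.sum_eq_zero, zero_add,
    hQ.coeff_natDegree, one_smul, Finset.sum_range_succ, Finset.sum_eq_zero, zero_add]
  · simp [h.top]; rfl
  · intro m hm
    rw [h.lt _ (Finset.mem_range.mp hm), TensorProduct.map_zero_left, smul_zero]
  · intro n hn
    rw [Finset.sum_eq_zero, smul_zero]
    intro m hm
    rw [h.lt _ (by have := Finset.mem_range.mp hn; have := Finset.mem_range.mp hm; omega),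
      TensorProduct.map_zero_left, smul_zero]

theorem compress_eq_zero (A : Module.End k V) (B : Module.End k W)
    (σ : V' →ₗ[k] V) (φ : W' →ₗ[k] W) (q : V →ₗ[k] V'') (π : W →ₗ[k] W'') (Q : k[X])
    (h : ∀ m, q ∘ₗ (A ^ m) ∘ₗ σ = 0) :
    TensorProduct.map q π ∘ₗ aeval (tensorSum A B) Q ∘ₗ TensorProduct.map σ φ = 0 := by
  rw [map_comp_aeval_tensorSum_comp_map]
  simp [h]

theorem finrank_le_finrank_range_of_comp_eq_id {U Y : Type*} [AddCommGroup U] [Module k U]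
    [FiniteDimensional k U] [AddCommGroup Y] [Module k Y] (s : Module.End k U) (α : Y →ₗ[k] U)
    (β : U →ₗ[k] Y) (h : β ∘ₗ s ∘ₗ α = LinearMap.id) :
    Module.finrank k Y ≤ Module.finrank k (LinearMap.range s) := by
  have hi : Function.Injective (s ∘ₗ α) :=
    Function.LeftInverse.injective (g := β) fun y => LinearMap.congr_fun h y
  rw [← LinearMap.finrank_range_of_inj hi]
  exact Submodule.finrank_mono (LinearMap.range_comp_le_range _ _)

/-- Tested against `β` and `δ`, the map `s` on the images of `α` and `γ` is block triangular with
identities on the diagonal, so `s ∘ (α, γ)` is injective. Nothing is needed about `β s γ`. -/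
theorem add_finrank_le_finrank_range {U Y Z : Type*} [AddCommGroup U] [Module k U]
    [FiniteDimensional k U] [AddCommGroup Y] [Module k Y] [FiniteDimensional k Y]
    [AddCommGroup Z] [Module k Z] [FiniteDimensional k Z] (s : Module.End k U)
    (α : Y →ₗ[k] U) (β : U →ₗ[k] Y) (γ : Z →ₗ[k] U) (δ : U →ₗ[k] Z)
    (hα : β ∘ₗ s ∘ₗ α = LinearMap.id) (hγ : δ ∘ₗ s ∘ₗ γ = LinearMap.id)
    (hδ : δ ∘ₗ s ∘ₗ α = 0) :
    Module.finrank k Y + Module.finrank k Z ≤ Module.finrank k (LinearMap.range s) := by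
  rw [← Module.finrank_prod]
  have hi : Function.Injective (s ∘ₗ α.coprod γ) := by
    rw [← LinearMap.ker_eq_bot, LinearMap.ker_eq_bot']
    rintro ⟨y, z⟩ hyz
    have h0 : s (α y) + s (γ z) = 0 := by simpa using hyz
    have e1 := LinearMap.congr_fun hα y
    have e2 := LinearMap.congr_fun hγ z
    have e3 := LinearMap.congr_fun hδ y
    simp only [LinearMap.comp_apply, LinearMap.id_apply, LinearMap.zero_apply] at e1 e2 e3
    have hz : z = 0 := by simpa [e2, e3] using congrArg δ h0
    subst hz
    have hy : y = 0 := by simpa [e1] using congrArg β h0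
    rw [hy]; rfl
  rw [← LinearMap.finrank_range_of_inj hi]
  exact Submodule.finrank_mono (LinearMap.range_comp_le_range _ _)

/-- The subspace `∑ᵢ Bⁱ φ(N)`. -/
noncomputable def cyclicSpan (B : Module.End k W) (φ : N →ₗ[k] W) : Submodule k W :=
  ⨆ i : ℕ, LinearMap.range ((B ^ i) ∘ₗ φ)

theorem pow_mem_cyclicSpan (B : Module.End k W) (φ : N →ₗ[k] W) (i : ℕ) (n : N) :
    (B ^ i) (φ n) ∈ cyclicSpan B φ :=
  (le_iSup (fun i : ℕ => LinearMap.range ((B ^ i) ∘ₗ φ)) i) ⟨n, rfl⟩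

variable [FiniteDimensional k V] [FiniteDimensional k N]

theorem IsTopPairing.mul_le_finrank_range [FiniteDimensional k W] {B : Module.End k W} {Q : k[X]} (hQ : Q.Monic)
    {φ : N →ₗ[k] W} {π : W →ₗ[k] N} (h : IsTopPairing B Q.natDegree φ π) (A : Module.End k V) :
    Module.finrank k V * Module.finrank k N ≤
      Module.finrank k (LinearMap.range (aeval (tensorSum A B) Q)) := by
  rw [← Module.finrank_tensorProduct]
  refine finrank_le_finrank_range_of_comp_eq_id _ (TensorProduct.map LinearMap.id φ)
    (TensorProduct.map LinearMap.id π) ?_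
  rw [h.compress_right hQ]
  simp

/-- Compressing with the pairing on the left factor accounts for rank `dim N · dim W`. A complement
of `cyclicSpan B φ` on the left, paired on the right, adds `dim (W / cyclicSpan) · dim N`; the cross
term vanishes since the quotient map kills every `Bᵐ φ`. The assumed bound leaves room only for a
zero quotient. -/
theorem IsTopPairing.cyclicSpan_eq_top [FiniteDimensional k W] {B : Module.End k W} {Q : k[X]} (hQ : Q.Monic)
    {φ : N →ₗ[k] W} {π : W →ₗ[k] N} (h : IsTopPairing B Q.natDegree φ π)
    (hN : 0 < Module.finrank k N)
    (hle : Module.finrank k (LinearMap.range (aeval (tensorSum B B) Q)) ≤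
      Module.finrank k W * Module.finrank k N) : cyclicSpan B φ = ⊤ := by
  obtain ⟨σ, hσ⟩ := (cyclicSpan B φ).mkQ.exists_rightInverse_of_surjective
    (Submodule.range_mkQ _)
  have key := add_finrank_le_finrank_range (aeval (tensorSum B B) Q)
    (TensorProduct.map φ LinearMap.id) (TensorProduct.map π LinearMap.id)
    (TensorProduct.map σ φ) (TensorProduct.map (cyclicSpan B φ).mkQ π)
    (by rw [h.compress_left hQ]; simp)
    (by rw [h.compress_right hQ, hσ]; simp)
    (by
      apply compress_eq_zero
      intro m
      ext n
      exact (Submodule.Quotient.mk_eq_zero _).mpr (pow_mem_cyclicSpan B φ m n))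
  rw [Module.finrank_tensorProduct, Module.finrank_tensorProduct, mul_comm] at key
  have : Module.finrank k (W ⧸ cyclicSpan B φ) * Module.finrank k N = 0 := by omega
  have h0 : Module.finrank k (W ⧸ cyclicSpan B φ) = 0 := by
    rcases Nat.mul_eq_zero.mp this with h | h <;> omega
  rw [Module.finrank_zero_iff, Submodule.Quotient.subsingleton_iff] at h0
  exact h0

/-- On the range of `S` the operator `tensorSum A B` is the scalar `g`. Hence `S` maps `V ⊗ Bⁱ φ(N)`
into the image of `V ⊗ φ(N)` for every `i`, and these subspaces span. -/
theorem finrank_range_aeval_tensorSum_le {A : Module.End k V} {B : Module.End k W} {Q : k[X]}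
    {g : k} (h0 : aeval (tensorSum A B) ((X - C g) * Q) = 0) (φ : N →ₗ[k] W)
    (hφ : cyclicSpan B φ = ⊤) :
    Module.finrank k (LinearMap.range (aeval (tensorSum A B) Q)) ≤
      Module.finrank k V * Module.finrank k N := by
  set S := aeval (tensorSum A B) Q with hS
  have hcomm : ∀ z, S (tensorSum A B z) = g • S z := by
    intro z
    have := LinearMap.congr_fun h0 z
    rw [mul_comm, map_mul, Module.End.mul_apply] at this
    simpa [sub_eq_zero] using this
  let U : Submodule k (V ⊗[k] W) :=
    (LinearMap.range (S ∘ₗ TensorProduct.map LinearMap.id φ)).comap S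
  have hU : ∀ z ∈ U, tensorSum A B z ∈ U := by
    intro z hz
    change S _ ∈ LinearMap.range _
    rw [hcomm]
    exact Submodule.smul_mem _ _ hz
  have h1 : ∀ (i : ℕ) (v : V) (n : N), v ⊗ₜ[k] (B ^ i) (φ n) ∈ U := by
    intro i
    induction i with
    | zero => exact fun v n => ⟨v ⊗ₜ n, rfl⟩
    | succ i ih =>
      intro v n
      -- `v ⊗ B w = (A ⊗ 1 + 1 ⊗ B)(v ⊗ w) - A v ⊗ w`.
      have := U.sub_mem (hU _ (ih v n)) (ih (A v) n)
      rw [tensorSum_tmul, add_sub_cancel_left] at this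
      rwa [pow_succ', Module.End.mul_apply]
  have hUtop : U = ⊤ := by
    rw [eq_top_iff, ← TensorProduct.span_tmul_eq_top, Submodule.span_le]
    rintro _ ⟨v, w, rfl⟩
    have hw : cyclicSpan B φ ≤ U.comap (TensorProduct.mk k V W v) := by
      refine iSup_le fun i => ?_
      rintro _ ⟨n, rfl⟩
      exact h1 i v n
    exact hw (hφ ▸ Submodule.mem_top)
  rw [← Module.finrank_tensorProduct]
  refine (Submodule.finrank_mono ?_).trans (LinearMap.finrank_range_le
    (S ∘ₗ TensorProduct.map LinearMap.id φ))
  rintro _ ⟨z, rfl⟩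
  exact (hUtop ▸ Submodule.mem_top : z ∈ U)

end TensorSum

/-! ### Free modules over the algebra generated by one endomorphism -/

section FreeModules

variable {k : Type*} [Field k]

/-- Vectors are chosen one at a time. The bad choices for each `i` form a proper subspace because
the rank is at least `r`, and a vector space over an infinite field is not a finite union of proper
subspaces. -/
theorem exists_linearIndependent_comp [Infinite k] {H : Type*} [AddCommGroup H] [Module k H]
    {ι : Type*} [Finite ι] (S : ι → Module.End k H) {r : ℕ}
    (hr : ∀ i, r ≤ Module.finrank k (LinearMap.range (S i))) :
    ∃ w : Fin r → H, ∀ i, LinearIndependent k (S i ∘ w) := by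
  suffices ∀ t ≤ r, ∃ w : Fin t → H, ∀ i, LinearIndependent k (S i ∘ w) from this r le_rfl
  intro t
  induction t with
  | zero => exact fun _ => ⟨Fin.elim0, fun i => linearIndependent_empty_type⟩
  | succ t ih =>
    intro ht
    obtain ⟨w, hw⟩ := ih (by omega)
    have hcover : ⋃ i, ((Submodule.span k (Set.range (S i ∘ w))).comap (S i) : Set H) ≠
        Set.univ := by
      intro h
      obtain ⟨i, hi⟩ := Subspace.exists_eq_top_of_iUnion_eq_univ h
      have hle : LinearMap.range (S i) ≤ Submodule.span k (Set.range (S i ∘ w)) := by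
        rintro _ ⟨z, rfl⟩
        exact (hi ▸ Submodule.mem_top : z ∈ (Submodule.span k (Set.range (S i ∘ w))).comap (S i))
      have := FiniteDimensional.span_of_finite k (Set.finite_range (S i ∘ w))
      have h1 := Submodule.finrank_mono hle
      rw [finrank_span_eq_card (hw i), Fintype.card_fin] at h1
      have := hr i
      omega
    obtain ⟨v, hv⟩ := (Set.ne_univ_iff_exists_notMem _).mp hcover
    refine ⟨Fin.snoc w v, fun i => ?_⟩
    rw [Fin.comp_snoc, linearIndependent_finSnoc]
    exact ⟨hw i, fun h => hv (Set.mem_iUnion.mpr ⟨i, h⟩)⟩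

/-- Linear factors of `P` are peeled off one by one: a monic common divisor `D` of `P` and all `u j`
is enlarged by a root of `P / D` until it equals `P`. -/
theorem dvd_of_sum_aeval_eq_zero [IsAlgClosed k] {H : Type*} [AddCommGroup H] [Module k H]
    {T : Module.End k H} {P : k[X]} (hP : P.Monic) (hT : aeval T P = 0) {ι : Type*} [Fintype ι]
    {w : ι → H}
    (hw : ∀ (g : k) (Q : k[X]), P = (X - C g) * Q → LinearIndependent k (aeval T Q ∘ w))
    {u : ι → k[X]} (hu : ∑ j, aeval T (u j) (w j) = 0) (j : ι) : P ∣ u j := by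
  have key : ∀ n ≤ P.natDegree, ∃ D : k[X], D.Monic ∧ D.natDegree = n ∧ D ∣ P ∧ ∀ j, D ∣ u j := by
    intro n
    induction n with
    | zero => exact fun _ => ⟨1, monic_one, natDegree_one, one_dvd _, fun _ => one_dvd _⟩
    | succ n ih =>
      intro hn
      obtain ⟨D, hDm, hDn, ⟨R, hR⟩, hDu⟩ := ih (by omega)
      choose u' hu' using hDu
      have hRdeg : R.degree ≠ 0 := by
        intro h
        have hR0 : R ≠ 0 := by rintro rfl; simp at h
        have := congrArg natDegree hR
        rw [natDegree_mul hDm.ne_zero hR0, natDegree_eq_zero_iff_degree_le_zero.mpr h.le] at this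
        omega
      obtain ⟨g, hg⟩ := IsAlgClosed.exists_root R hRdeg
      obtain ⟨R', rfl⟩ := dvd_iff_isRoot.mpr hg
      have hQ : P = (X - C g) * (D * R') := by rw [hR]; ring
      have hz : ∀ j, (u' j).eval g = 0 := by
        refine Fintype.linearIndependent_iff.mp (hw g _ hQ) (fun j => (u' j).eval g) ?_
        have h1 : aeval T R' (∑ j, aeval T (u j) (w j)) = 0 := by rw [hu, map_zero]
        rw [map_sum] at h1
        rw [← h1]
        refine Finset.sum_congr rfl fun j _ => ?_
        obtain ⟨v, hv⟩ := X_sub_C_dvd_sub_C_eval (a := g) (p := u' j)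
        -- Modulo `P`, multiplying `u j = D u' j` by `R'` leaves only the value of `u' j` at `g`
        -- times `P / (X - g)`. Independence for this quotient then makes the value zero.
        have h2 : R' * u j = P * v + C ((u' j).eval g) * (D * R') := by
          rw [hu' j, hQ, eq_add_of_sub_eq hv]
          simp
          ring
        rw [← Module.End.mul_apply, ← map_mul, h2, map_add, map_mul _ P, hT, map_mul _ (C _)]
        simp
      refine ⟨D * (X - C g), hDm.mul (monic_X_sub_C g), ?_, ⟨R', by rw [hR]; ring⟩, fun j => ?_⟩
      · rw [hDm.natDegree_mul (monic_X_sub_C g), hDn, natDegree_X_sub_C]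
      · rw [hu' j]
        exact mul_dvd_mul_left _ (dvd_iff_isRoot.mpr (hz j))
  obtain ⟨D, hDm, hDn, hDP, hDu⟩ := key _ le_rfl
  rw [eq_of_monic_of_dvd_of_natDegree_le hDm hP hDP hDn.ge]
  exact hDu j

theorem linearIndependent_pow_apply [IsAlgClosed k] {H : Type*} [AddCommGroup H] [Module k H]
    {T : Module.End k H} {P : k[X]} (hP : P.Monic) (hT : aeval T P = 0) {ι : Type*} [Fintype ι]
    {w : ι → H}
    (hw : ∀ (g : k) (Q : k[X]), P = (X - C g) * Q → LinearIndependent k (aeval T Q ∘ w)) :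
    LinearIndependent k fun ij : Fin P.natDegree × ι => (T ^ (ij.1 : ℕ)) (w ij.2) := by
  rw [Fintype.linearIndependent_iff]
  intro a ha ij
  let u : ι → k[X] := fun j => ∑ i : Fin P.natDegree, C (a (i, j)) * X ^ (i : ℕ)
  have hu : ∑ j, aeval T (u j) (w j) = 0 := by
    rw [← ha, Fintype.sum_prod_type_right]
    refine Finset.sum_congr rfl fun j _ => ?_
    simp [u, LinearMap.sum_apply]
  have hdeg : (u ij.2).degree < P.degree := by
    rw [degree_eq_natDegree hP.ne_zero]
    refine (degree_sum_le _ _).trans_lt ?_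
    rw [Finset.sup_lt_iff (WithBot.bot_lt_coe _)]
    intro i _
    exact (degree_C_mul_X_pow_le _ _).trans_lt (by exact_mod_cast i.2)
  have h0 := eq_zero_of_dvd_of_degree_lt (dvd_of_sum_aeval_eq_zero hP hT hw hu ij.2) hdeg
  have h1 := congrArg (fun q : k[X] => q.coeff (ij.1 : ℕ)) h0
  simpa [u, finsetSum_coeff, coeff_C_mul, coeff_X_pow, Fin.val_inj] using h1

/-- `π` is a left inverse of the inclusion of the free part, followed by reading off the coordinates
at `Tᵉ`. -/
theorem exists_isTopPairing {H : Type*} [AddCommGroup H] [Module k H] {T : Module.End k H}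
    {e : ℕ} {ι : Type*} [Fintype ι] [DecidableEq ι] {w : ι → H}
    (hw : LinearIndependent k fun ij : Fin (e + 1) × ι => (T ^ (ij.1 : ℕ)) (w ij.2)) :
    ∃ π : H →ₗ[k] (ι → k), IsTopPairing T e (Fintype.linearCombination k w) π := by
  obtain ⟨π, hπ⟩ := (Fintype.linearCombination k
    fun ij : Fin (e + 1) × ι => (T ^ (ij.1 : ℕ)) (w ij.2)).exists_leftInverse_of_injective
      (LinearMap.ker_eq_bot.mpr hw.fintypeLinearCombination_injective)
  have hπ' : ∀ (i : Fin (e + 1)) (j : ι), π ((T ^ (i : ℕ)) (w j)) = Pi.single (i, j) 1 := by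
    intro i j
    have := LinearMap.congr_fun hπ (Pi.single (i, j) 1)
    simpa [Fintype.linearCombination_apply_single] using this
  refine ⟨LinearMap.funLeft k k (fun j => (Fin.last e, j)) ∘ₗ π, ⟨fun i hi => ?_, ?_⟩⟩
  · ext j j'
    have := hπ' ⟨i, by omega⟩ j
    simp only at this
    simp [Fintype.linearCombination_apply_single, this, LinearMap.funLeft_apply,
      Pi.single_apply, Fin.ext_iff]
    omega
  · ext j j'
    have := hπ' (Fin.last e) j
    simp only [Fin.val_last] at this
    simp [Fintype.linearCombination_apply_single, this, LinearMap.funLeft_apply,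
      Pi.single_apply]

/-- If tensoring with `(H, T)` trivialises the ranks of the polynomials `P / (X - g)` on `H` and on
`V`, then the degree of `P` divides the dimension of `V`. -/
theorem natDegree_dvd_finrank [IsAlgClosed k] {P : k[X]} (hP : P.Monic) (hadd : P.IsAdditive)
    {H : Type*} [AddCommGroup H] [Module k H] [FiniteDimensional k H] {T : Module.End k H}
    (hT : aeval T P = 0) (hne : ∀ g, P.IsRoot g → aeval T (P /ₘ (X - C g)) ≠ 0)
    (hH : ∀ Q : k[X], Module.finrank k (LinearMap.range (aeval (tensorSum T T) Q)) =
      Module.finrank k (LinearMap.range (aeval T Q)) * Module.finrank k H)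
    {V : Type*} [AddCommGroup V] [Module k V] [FiniteDimensional k V] {A : Module.End k V}
    (hA : aeval A P = 0)
    (hV : ∀ Q : k[X], Module.finrank k (LinearMap.range (aeval (tensorSum A T) Q)) =
      Module.finrank k (LinearMap.range (aeval A Q)) * Module.finrank k H) :
    P.natDegree ∣ Module.finrank k V := by
  have hroot : ∃ g, P.IsRoot g := by
    refine IsAlgClosed.exists_root P fun h => ?_
    have h1 := hP.coeff_natDegree
    rw [natDegree_eq_zero_iff_degree_le_zero.mpr h.le, hadd.coeff_zero] at h1
    exact zero_ne_one h1
  let ι := {g : k // P.IsRoot g}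
  have : Nonempty ι := hroot.elim fun g hg => ⟨⟨g, hg⟩⟩
  have : Finite ι := (finite_setOfPred_isRoot hP.ne_zero).to_subtype
  have : Infinite k := IsAlgClosed.instInfinite
  let S : ι → Module.End k H := fun g => aeval T (P /ₘ (X - C g.1))
  have hS : ∀ g : ι, (X - C g.1) * (P /ₘ (X - C g.1)) = P := fun g =>
    mul_divByMonic_eq_iff_isRoot.mpr g.2
  -- With `g` of minimal rank, `r` vectors can be chosen that work for all roots simultaneously and
  -- still exhaust the rank at `g`.
  obtain ⟨g, hg⟩ := Finite.exists_min fun g : ι => Module.finrank k (LinearMap.range (S g))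
  set r := Module.finrank k (LinearMap.range (S g)) with hr
  have hrpos : 0 < r := by
    rw [hr, Module.finrank_pos_iff, Submodule.nontrivial_iff_ne_bot, Ne, LinearMap.range_eq_bot]
    exact hne g.1 g.2
  obtain ⟨w, hw⟩ := exists_linearIndependent_comp S hg
  set Q := P /ₘ (X - C g.1)
  have hQP : (X - C g.1) * Q = P := hS g
  have hQ : Q.Monic := Monic.of_mul_monic_left (monic_X_sub_C g.1) (by rw [hQP]; exact hP)
  have hdeg : P.natDegree = Q.natDegree + 1 := by
    rw [← hQP, (monic_X_sub_C g.1).natDegree_mul hQ, natDegree_X_sub_C, add_comm]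
  have hind := linearIndependent_pow_apply hP hT (w := w) (by
    intro g' Q' h
    have hr' : P.IsRoot g' := dvd_iff_isRoot.mp ⟨Q', h⟩
    have : Q' = P /ₘ (X - C g') := by
      rw [h, mul_divByMonic_cancel_left _ (monic_X_sub_C g')]
    rw [this]
    exact hw ⟨g', hr'⟩)
  rw [hdeg] at hind
  obtain ⟨π, h⟩ := exists_isTopPairing hind
  have hN : Module.finrank k (Fin r → k) = r := by simp
  -- The rank at `g` on `H ⊗ H` is exactly `r · dim H`, so the free submodule generated by `w` is
  -- all of `H`.
  have htop := h.cyclicSpan_eq_top hQ (by rw [hN]; exact hrpos)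
    (by rw [hH, hN, mul_comm])
  have eq1 : Module.finrank k V * r = Module.finrank k (LinearMap.range (aeval A Q)) *
      Module.finrank k H := by
    rw [← hV]
    refine le_antisymm ?_ ?_
    · simpa [hN] using h.mul_le_finrank_range hQ A
    · simpa [hN] using finrank_range_aeval_tensorSum_le (g := g.1) (A := A) (B := T) (Q := Q)
        (by rw [hQP]; exact hadd.aeval_tensorSum hA hT) _ htop
  have eq2 : Module.finrank k H = P.natDegree * r := by
    refine le_antisymm ?_ ?_
    · let Φ := Fintype.linearCombination k
        fun ij : Fin P.natDegree × Fin r => (T ^ (ij.1 : ℕ)) (w ij.2)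
      have hΦ : LinearMap.range Φ = ⊤ := by
        rw [eq_top_iff, ← htop]
        refine iSup_le fun i => ?_
        rintro _ ⟨n, rfl⟩
        have hmem : ∀ j, (T ^ i) (w j) ∈ LinearMap.range Φ := by
          intro j
          -- Powers beyond the degree reduce modulo `P`.
          have hT' : T ^ i = aeval T (X ^ i %ₘ P) := by
            have := congrArg (aeval T) (modByMonic_add_div (X ^ i : k[X]) P)
            rw [map_add, map_mul, hT, zero_mul, add_zero] at this
            rw [this]
            simp
          rw [hT', aeval_eq_sum_range' (natDegree_modByMonic_lt _ hP (by rintro rfl; simp at hdeg)),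
            Finset.sum_range, LinearMap.sum_apply]
          refine Submodule.sum_mem _ fun i _ => ?_
          rw [LinearMap.smul_apply]
          refine Submodule.smul_mem _ _ ⟨Pi.single (i, j) 1, ?_⟩
          simp [Φ, Fintype.linearCombination_apply_single]
        rw [LinearMap.comp_apply, Fintype.linearCombination_apply, map_sum]
        refine Submodule.sum_mem _ fun j _ => ?_
        rw [map_smul]
        exact Submodule.smul_mem _ _ (hmem j)
      have := LinearMap.finrank_range_le Φ
      rw [hΦ, finrank_top] at this
      simpa using this
    · have := hind.fintype_card_le_finrank
      rw [hdeg]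
      simpa using this
  refine ⟨Module.finrank k (LinearMap.range (aeval A Q)), ?_⟩
  rw [eq2] at eq1
  exact Nat.eq_of_mul_eq_mul_right hrpos (by rw [eq1]; ring)

end FreeModules

/-! ### The minimal polynomial of a primitive element -/

section PrimitiveElements

variable {k : Type*} [Field k] {H : Type*} [Ring H]

namespace IsPrimitiveElement

section Bialgebra

variable [Bialgebra k H] {x : H}

theorem counit_eq_zero (hx : IsPrimitiveElement k x) : Coalgebra.counit (R := k) x = 0 := by
  have h := Coalgebra.lTensor_counit_comul (R := k) x
  rw [hx, map_add, LinearMap.lTensor_tmul, LinearMap.lTensor_tmul, Bialgebra.counit_one,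
    add_eq_left] at h
  simpa using congrArg (TensorProduct.lid k k ∘ (Coalgebra.counit (R := k)).rTensor k) h

theorem comul_pow (hx : IsPrimitiveElement k x) (n : ℕ) :
    Coalgebra.comul (R := k) (x ^ n) =
      ∑ m ∈ Finset.range (n + 1), (n.choose m : k) • (x ^ m) ⊗ₜ[k] (x ^ (n - m)) := by
  have hc : Commute (x ⊗ₜ[k] (1 : H)) ((1 : H) ⊗ₜ[k] x) := by
    simp [Commute, SemiconjBy]
  rw [Bialgebra.comul_pow, hx, hc.add_pow]
  refine Finset.sum_congr rfl fun m _ => ?_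
  rw [← nsmul_eq_mul', ← Nat.cast_smul_eq_nsmul k]
  simp [Algebra.TensorProduct.tmul_pow]

theorem aeval_of_isAdditive (hx : IsPrimitiveElement k x) {P : k[X]} (hP : P.IsAdditive) :
    IsPrimitiveElement k (aeval x P) := by
  have hc : Commute (x ⊗ₜ[k] (1 : H)) ((1 : H) ⊗ₜ[k] x) := by
    simp [Commute, SemiconjBy]
  have h1 : Coalgebra.comul (R := k) (aeval x P) = aeval (Coalgebra.comul (R := k) x) P :=
    (aeval_algHom_apply (Bialgebra.comulAlgHom k H) x P).symm
  have h2 := aeval_algHom_apply (Algebra.TensorProduct.includeLeft : H →ₐ[k] H ⊗[k] H) x P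
  have h3 := aeval_algHom_apply (Algebra.TensorProduct.includeRight : H →ₐ[k] H ⊗[k] H) x P
  rw [IsPrimitiveElement, h1, hx, hP.aeval_add hc]
  exact congrArg₂ _ h2 h3

theorem exists_dual_pow (x : H) : ∃ f : ℕ → H →ₗ[k] k, ∀ i < (minpoly k x).natDegree,
    ∀ j < (minpoly k x).natDegree, f i (x ^ j) = if j = i then 1 else 0 := by
  obtain ⟨F, hF⟩ := (Fintype.linearCombination k
    fun i : Fin (minpoly k x).natDegree => x ^ (i : ℕ)).exists_leftInverse_of_injective
      (LinearMap.ker_eq_bot.mpr (linearIndependent_pow x).fintypeLinearCombination_injective)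
  -- The forms with index at least the degree are set to `0`; the claim does not concern them.
  refine ⟨fun i => if h : i < (minpoly k x).natDegree then LinearMap.proj ⟨i, h⟩ ∘ₗ F else 0,
    fun i hi j hj => ?_⟩
  have := LinearMap.congr_fun hF (Pi.single ⟨j, hj⟩ 1)
  simp only [LinearMap.comp_apply, Fintype.linearCombination_apply_single, one_smul,
    LinearMap.id_apply] at this
  simp [hi, this, Pi.single_apply, eq_comm]

/-- The coefficient of `xⁱ ⊗ xʲ` in `Δ(P(x)) = 0` is read off with forms dual to the powers of `x`
below the degree. -/
theorem isAdditive_minpoly [FiniteDimensional k H] (hx : IsPrimitiveElement k x) :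
    (minpoly k x).IsAdditive := by
  set P := minpoly k x with hPdef
  constructor
  · have h1 := aeval_algHom_apply (Bialgebra.counitAlgHom k H) x P
    have h2 : Bialgebra.counitAlgHom k H x = 0 := hx.counit_eq_zero
    rw [minpoly.aeval, map_zero, h2] at h1
    rwa [aeval_def, eval₂_at_zero, Algebra.algebraMap_self, RingHom.id_apply] at h1
  · intro i j hi hj
    rcases lt_or_ge P.natDegree (i + j) with hd | hd
    · rw [coeff_eq_zero_of_natDegree_lt hd, zero_mul]
    obtain ⟨f, hf⟩ := exists_dual_pow (k := k) x
    rw [← hPdef] at hf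
    have h0 : Coalgebra.comul (R := k) (aeval x P) = 0 := by rw [minpoly.aeval, map_zero]
    rw [aeval_eq_sum_range, map_sum] at h0
    have h1 := congrArg (LinearMap.mul' k k ∘ TensorProduct.map (f i) (f j)) h0
    have key : ∀ n ∈ Finset.range (P.natDegree + 1), ∀ m ∈ Finset.range (n + 1),
        f i (x ^ m) * f j (x ^ (n - m)) = if n = i + j then (if m = i then 1 else 0) else 0 := by
      intro n hn m hm
      have hn' := Finset.mem_range.mp hn
      have hm' := Finset.mem_range.mp hm
      -- The power `x ^ P.natDegree` lies outside the range of the dual forms. It occurs only beside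
      -- `x ^ 0`, which `f i` and `f j` kill since `i` and `j` are positive.
      rcases eq_or_ne m P.natDegree with rfl | hmd
      · have : n - P.natDegree = 0 := by omega
        rw [this, hf j (by omega) 0 (by omega), if_neg (by omega : 0 ≠ j), mul_zero]
        split_ifs <;> first | rfl | omega
      rcases eq_or_ne (n - m) P.natDegree with hnm | hnm
      · have : m = 0 := by omega
        rw [this, hf i (by omega) 0 (by omega), if_neg (by omega : 0 ≠ i), zero_mul]
        split_ifs <;> rfl
      rw [hf i (by omega) m (by omega), hf j (by omega) _ (by omega)]
      split_ifs <;> first | omega | simp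
    simp only [Function.comp_apply, map_sum, map_smul, hx.comul_pow, TensorProduct.map_tmul,
      LinearMap.mul'_apply, map_zero, smul_eq_mul] at h1
    rw [Finset.sum_congr rfl fun n hn => congrArg _ (Finset.sum_congr rfl fun m hm =>
      congrArg _ (key n hn m hm)), Finset.sum_eq_single (i + j)] at h1
    · simpa [Finset.sum_ite_eq'] using h1
    · intro n _ hn
      simp [hn]
    · intro h
      exact absurd (Finset.mem_range.mpr (by omega)) h

end Bialgebra

end IsPrimitiveElement

theorem finrank_adjoin_singleton_eq_natDegree [Algebra k H] [FiniteDimensional k H] (x : H) :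
    Module.finrank k (Algebra.adjoin k {x}) = (minpoly k x).natDegree := by
  rw [Algebra.adjoin_singleton_eq_range_aeval,
    ← (Ideal.quotientKerAlgEquivOfSurjective (aeval x : k[X] →ₐ[k] H).rangeRestrict_surjective
      ).toLinearEquiv.finrank_eq, ← finrank_quotient_span_eq_natDegree]
  have : RingHom.ker (aeval x : k[X] →ₐ[k] H).rangeRestrict = Ideal.span {minpoly k x} := by
    ext q
    rw [Ideal.mem_span_singleton, minpoly.dvd_iff, RingHom.mem_ker, Subtype.ext_iff]
    rfl
  exact (Ideal.quotientEquivAlgOfEq k this).toLinearEquiv.finrank_eq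

theorem exists_algHom_adjoin_singleton [Algebra k H] [FiniteDimensional k H] (x : H)
    {A : Type*} [Ring A] [Algebra k A] (a : A) (ha : aeval a (minpoly k x) = 0) :
    ∃ act : Algebra.adjoin k {x} →ₐ[k] A,
      act ⟨x, Algebra.self_mem_adjoin_singleton k x⟩ = a := by
  let π : k[X] →ₐ[k] Algebra.adjoin k {x} := aeval ⟨x, Algebra.self_mem_adjoin_singleton k x⟩
  have hval : ∀ q, ((π q : Algebra.adjoin k {x}) : H) = aeval x q := fun q =>
    (aeval_algHom_apply (Algebra.adjoin k {x}).val _ q).symm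
  have hπ : Function.Surjective π := by
    rintro ⟨u, hu⟩
    have hu' := hu
    rw [Algebra.adjoin_singleton_eq_range_aeval] at hu'
    obtain ⟨q, hq⟩ := hu'
    exact ⟨q, Subtype.ext ((hval q).trans hq)⟩
  have hker : ∀ q ∈ RingHom.ker π, aeval a q = 0 := by
    intro q hq
    obtain ⟨s, rfl⟩ := minpoly.dvd k x
      ((hval q).symm.trans (congrArg Subtype.val (RingHom.mem_ker.mp hq)))
    rw [map_mul, ha, zero_mul]
  refine ⟨(Ideal.Quotient.liftₐ (RingHom.ker π) (aeval a) hker).comp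
    (Ideal.quotientKerAlgEquivOfSurjective hπ).symm.toAlgHom, ?_⟩
  have : (Ideal.quotientKerAlgEquivOfSurjective hπ).symm
      ⟨x, Algebra.self_mem_adjoin_singleton k x⟩ = Ideal.Quotient.mk _ X := by
    rw [AlgEquiv.symm_apply_eq]
    exact (aeval_X _).symm
  change Ideal.Quotient.liftₐ (RingHom.ker π) (aeval a) hker
    ((Ideal.quotientKerAlgEquivOfSurjective hπ).symm _) = a
  rw [this]
  exact aeval_X a

end PrimitiveElements

/-! ### Hopf modules over `k[x]` from a single operator -/

section HopfModuleCriterion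

variable {k : Type*} [Field k] {H : Type*} [Ring H] [Bialgebra k H] {M : Type*} [AddCommGroup M]
  [Module k M]

theorem tensorAct_tmul_apply {K : Subalgebra k H} (act : K →ₐ[k] Module.End k M) (u v : K) :
    tensorAct (H := H) act (u ⊗ₜ v) =
      TensorProduct.map (act u) (LinearMap.mulLeft k (v : H)) := rfl

theorem tensorAct_mul {K : Subalgebra k H} (act : K →ₐ[k] Module.End k M) (a b : K ⊗[k] K) :
    tensorAct (H := H) act (a * b) = tensorAct act a * tensorAct act b := by
  induction a with
  | zero => simp
  | add a a' ha ha' => rw [add_mul, map_add, map_add, add_mul, ha, ha']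
  | tmul u v =>
    induction b with
    | zero => simp
    | add b b' hb hb' => rw [mul_add, map_add, map_add, mul_add, hb, hb']
    | tmul u' v' =>
      rw [Algebra.TensorProduct.tmul_mul_tmul]
      simp only [tensorAct_tmul_apply]
      ext m h
      simp

theorem IsSubbialgebra.comul_primitive {x : H} (hx : IsPrimitiveElement k x) :
    hx.isSubbialgebra_adjoin.comul ⟨x, Algebra.self_mem_adjoin_singleton k x⟩ =
      ⟨x, Algebra.self_mem_adjoin_singleton k x⟩ ⊗ₜ 1 +
        1 ⊗ₜ ⟨x, Algebra.self_mem_adjoin_singleton k x⟩ := by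
  apply IsSubbialgebra.map_val_injective
  rw [IsSubbialgebra.map_comul]
  exact hx.trans (by simp)

/-- The compatibility condition is linear and multiplicative in `u`, so it suffices on the
generator, where `Δ(x)` acts as `tensorSum`. -/
theorem isHopfModule_of_primitive {x : H} (hx : IsPrimitiveElement k x)
    (act : Algebra.adjoin k {x} →ₐ[k] Module.End k M) (ρ : RightComodule k H M)
    (h : ∀ m, ρ.coact (act ⟨x, Algebra.self_mem_adjoin_singleton k x⟩ m) =
      tensorSum (act ⟨x, Algebra.self_mem_adjoin_singleton k x⟩) (LinearMap.mulLeft k x)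
        (ρ.coact m)) :
    IsHopfModule hx.isSubbialgebra_adjoin act ρ := by
  have hy : tensorAct (H := H) act (hx.isSubbialgebra_adjoin.comul
      ⟨x, Algebra.self_mem_adjoin_singleton k x⟩) =
      tensorSum (act ⟨x, Algebra.self_mem_adjoin_singleton k x⟩) (LinearMap.mulLeft k x) := by
    rw [IsSubbialgebra.comul_primitive hx, map_add, tensorAct_tmul_apply, tensorAct_tmul_apply,
      map_one, tensorSum]
    congr 1
    ext m h
    simp
  rintro ⟨u, hu⟩
  have h1 : tensorAct (H := H) act 1 = 1 := by
    rw [Algebra.TensorProduct.one_def, tensorAct_tmul_apply]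
    ext m h
    simp
  induction hu using Algebra.adjoin_induction with
  | mem u hu =>
    obtain rfl : u = x := hu
    intro m
    rw [hy]
    exact h m
  | algebraMap r =>
    intro m
    have : (⟨algebraMap k H r, Subalgebra.algebraMap_mem _ r⟩ : Algebra.adjoin k {x}) =
      algebraMap k _ r := rfl
    rw [this, AlgHom.commutes, AlgHom.commutes, Algebra.algebraMap_eq_smul_one,
      Algebra.algebraMap_eq_smul_one, map_smul, h1]
    simp
  | add u v hu hv ihu ihv =>
    intro m
    have : (⟨u + v, add_mem hu hv⟩ : Algebra.adjoin k {x}) = ⟨u, hu⟩ + ⟨v, hv⟩ := rfl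
    rw [this, map_add, map_add, map_add, LinearMap.add_apply, map_add, ihu, ihv,
      LinearMap.add_apply]
  | mul u v hu hv ihu ihv =>
    intro m
    have : (⟨u * v, mul_mem hu hv⟩ : Algebra.adjoin k {x}) = ⟨u, hu⟩ * ⟨v, hv⟩ := rfl
    rw [this, map_mul, map_mul, tensorAct_mul, Module.End.mul_apply, Module.End.mul_apply, ihu,
      ihv]

end HopfModuleCriterion

/-! ### Untwisting `M ⊗ H` -/

section HopfIsomorphism

variable {k : Type*} [Field k] {H : Type*} [Ring H] {M : Type*} [AddCommGroup M] [Module k M]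

theorem finrank_range_rTensor (W : Type*) [AddCommGroup W] [Module k W] (f : Module.End k M) :
    Module.finrank k (LinearMap.range (f.rTensor W)) =
      Module.finrank k (LinearMap.range f) * Module.finrank k W := by
  have h1 : f.rTensor W = (LinearMap.range f).subtype.rTensor W ∘ₗ f.rangeRestrict.rTensor W := by
    rw [← LinearMap.rTensor_comp]
    rfl
  have h2 : LinearMap.range (f.rTensor W) =
      LinearMap.range ((LinearMap.range f).subtype.rTensor W) := by
    rw [h1]
    exact LinearMap.range_comp_of_range_eq_top _ (LinearMap.range_eq_top.mpr
      (LinearMap.rTensor_surjective W f.surjective_rangeRestrict))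
  rw [h2, LinearMap.finrank_range_of_inj (Module.Flat.rTensor_preserves_injective_linearMap _
    (Submodule.injective_subtype _)), Module.finrank_tensorProduct]

/-- The regular comodule. -/
def RightComodule.regular (k C : Type*) [Field k] [AddCommGroup C] [Module k C] [Coalgebra k C] :
    RightComodule k C C where
  coact := Coalgebra.comul
  coassoc := Coalgebra.coassoc
  counit_coact := Coalgebra.lTensor_counit_comp_comul

namespace RightComodule

/-- The map `m ⊗ h ↦ m₀ ⊗ m₁ h`. -/
noncomputable def twist [Bialgebra k H] (ρ : RightComodule k H M) : Module.End k (M ⊗[k] H) :=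
  (LinearMap.mul' k H).lTensor M ∘ₗ (TensorProduct.assoc k M H H).toLinearMap ∘ₗ
    ρ.coact.rTensor H

theorem twist_tmul [Bialgebra k H] (ρ : RightComodule k H M) (m : M) (h : H) :
    ρ.twist (m ⊗ₜ h) = (LinearMap.mulRight k h).lTensor M (ρ.coact m) := by
  change (LinearMap.mul' k H).lTensor M (TensorProduct.assoc k M H H (ρ.coact m ⊗ₜ h)) = _
  generalize ρ.coact m = z
  induction z with
  | zero => simp
  | add a b ha hb => rw [TensorProduct.add_tmul, map_add, map_add, ha, hb, map_add]
  | tmul m c => simp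

/-- Left multiplication by `x` commutes with right multiplication by `h`, so the compatibility of
`X` with the coaction passes to `twist`. -/
theorem tensorSum_twist [Bialgebra k H] (ρ : RightComodule k H M) {X : Module.End k M} {x : H}
    (h : ∀ m, ρ.coact (X m) = tensorSum X (LinearMap.mulLeft k x) (ρ.coact m)) :
    tensorSum X (LinearMap.mulLeft k x) * ρ.twist = ρ.twist * X.rTensor H := by
  ext m c
  change tensorSum X (LinearMap.mulLeft k x) (ρ.twist (m ⊗ₜ c)) = ρ.twist (X m ⊗ₜ c)
  rw [twist_tmul, twist_tmul, h]
  generalize ρ.coact m = z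
  induction z with
  | zero => simp
  | add a b ha hb => simp only [map_add, ha, hb]
  | tmul m c => simp [tensorSum_tmul, mul_assoc]

variable [HopfAlgebra k H]

/-- A preimage of `m ⊗ h` is `m₀ ⊗ S(m₁) h`, with `S` the antipode. -/
theorem twist_surjective (ρ : RightComodule k H M) : Function.Surjective ρ.twist := by
  rw [← LinearMap.range_eq_top, eq_top_iff, ← TensorProduct.span_tmul_eq_top, Submodule.span_le]
  rintro _ ⟨m, h, rfl⟩
  -- `μ` is `a ⊗ b ↦ a S(b) h`.
  let μ : H ⊗[k] H →ₗ[k] H := LinearMap.mulRight k h ∘ₗ LinearMap.mul' k H ∘ₗ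
    (HopfAlgebra.antipode k).lTensor H
  have h1 : ∀ z : M ⊗[k] H,
      ρ.twist ((LinearMap.mulRight k h ∘ₗ HopfAlgebra.antipode k).lTensor M z) =
        μ.lTensor M (TensorProduct.assoc k M H H (ρ.coact.rTensor H z)) := by
    intro z
    induction z with
    | zero => simp
    | add a b ha hb => simp only [map_add, ha, hb]
    | tmul m c =>
      rw [LinearMap.lTensor_tmul, LinearMap.rTensor_tmul, twist_tmul]
      generalize ρ.coact m = z
      induction z with
      | zero => simp
      | add a b ha hb => simp only [map_add, ha, hb, TensorProduct.add_tmul]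
      | tmul m d => simp [μ, mul_assoc]
  refine ⟨_, (h1 (ρ.coact m)).trans ?_⟩
  have h2 := LinearMap.congr_fun ρ.coassoc m
  simp only [LinearMap.comp_apply, LinearEquiv.coe_coe] at h2
  have h3 : μ ∘ₗ Coalgebra.comul = LinearMap.toSpanSingleton k H h ∘ₗ Coalgebra.counit := by
    ext c
    simp [μ, HopfAlgebra.mul_antipode_lTensor_comul_apply, Algebra.algebraMap_eq_smul_one]
  have h4 := LinearMap.congr_fun ρ.counit_coact m
  simp only [LinearMap.comp_apply] at h4
  rw [h2, ← LinearMap.comp_apply, ← LinearMap.lTensor_comp, h3, LinearMap.lTensor_comp,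
    LinearMap.comp_apply, h4]
  simp

theorem finrank_range_aeval_tensorSum [FiniteDimensional k H] [FiniteDimensional k M]
    (ρ : RightComodule k H M) {X : Module.End k M} {x : H}
    (h : ∀ m, ρ.coact (X m) = tensorSum X (LinearMap.mulLeft k x) (ρ.coact m)) (Q : k[X]) :
    Module.finrank k (LinearMap.range (aeval (tensorSum X (LinearMap.mulLeft k x)) Q)) =
      Module.finrank k (LinearMap.range (aeval X Q)) * Module.finrank k H := by
  have hs := ρ.twist_surjective
  have hi : Function.Injective ρ.twist := LinearMap.injective_iff_surjective.mpr hs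
  have hQ : aeval (tensorSum X (LinearMap.mulLeft k x)) Q ∘ₗ ρ.twist =
      ρ.twist ∘ₗ (aeval X Q).rTensor H := by
    rw [← aeval_rTensor]
    change (_ : Module.End k (M ⊗[k] H)) * ρ.twist = ρ.twist * _
    induction Q using Polynomial.induction_on' with
    | add p q hp hq => rw [map_add, map_add, add_mul, mul_add, hp, hq]
    | monomial n a =>
      have hpow : tensorSum X (LinearMap.mulLeft k x) ^ n * ρ.twist =
          ρ.twist * X.rTensor H ^ n :=
        (SemiconjBy.pow_right (ρ.tensorSum_twist h).symm n).symm
      simp only [aeval_monomial, Algebra.algebraMap_eq_smul_one, smul_mul_assoc, one_mul,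
        mul_smul_comm, hpow]
  rw [← finrank_range_rTensor, ← LinearMap.range_comp_of_range_eq_top _
    (LinearMap.range_eq_top.mpr hs), hQ, LinearMap.range_comp]
  exact (Submodule.equivMapOfInjective _ hi _).finrank_eq.symm

theorem natDegree_minpoly_dvd_finrank [IsAlgClosed k] [FiniteDimensional k H]
    [FiniteDimensional k M] {x : H} (hx : IsPrimitiveElement k x)
    (ρ : RightComodule k H M) {X : Module.End k M} (hX : aeval X (minpoly k x) = 0)
    (h : ∀ m, ρ.coact (X m) = tensorSum X (LinearMap.mulLeft k x) (ρ.coact m)) :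
    (minpoly k x).natDegree ∣ Module.finrank k M := by
  have hint : IsIntegral k x := Algebra.IsIntegral.isIntegral x
  have hm := minpoly.monic hint
  have hl : ∀ q : k[X], aeval (LinearMap.mulLeft k x) q = LinearMap.mulLeft k (aeval x q) :=
    fun q => aeval_algHom_apply (Algebra.lmul k H) x q
  refine natDegree_dvd_finrank hm hx.isAdditive_minpoly (T := LinearMap.mulLeft k x) ?_ ?_
    (finrank_range_aeval_tensorSum (regular k H) ?_) hX (ρ.finrank_range_aeval_tensorSum h)
  · rw [hl, minpoly.aeval, LinearMap.mulLeft_zero_eq_zero]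
  -- By minimality of `P`, the proper divisor `P / (X - g)` does not vanish at `x`.
  · intro g hg h0
    rw [hl, LinearMap.mulLeft_eq_zero_iff] at h0
    have hmul := mul_divByMonic_eq_iff_isRoot.mpr hg
    have hne : minpoly k x /ₘ (Polynomial.X - C g) ≠ 0 := by
      intro h
      rw [h, mul_zero] at hmul
      exact hm.ne_zero hmul.symm
    have h1 := natDegree_le_of_dvd (minpoly.dvd k x h0) hne
    have h2 := congrArg natDegree hmul
    rw [(monic_X_sub_C g).natDegree_mul' hne, natDegree_X_sub_C] at h2
    omega
  · intro m
    change Coalgebra.comul (x * m) = tensorSum _ _ (Coalgebra.comul m)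
    rw [Bialgebra.comul_mul, hx]
    generalize Coalgebra.comul (R := k) m = z
    induction z with
    | zero => simp
    | add a b ha hb => rw [mul_add, ha, hb, map_add]
    | tmul a b => simp [tensorSum_tmul, add_mul]

end RightComodule

end HopfIsomorphism

/-! ### Contractions of tensors by linear forms -/

section Contractions

variable {k : Type*} [Field k] {M N V W : Type*} [AddCommGroup M] [Module k M]
  [AddCommGroup N] [Module k N] [AddCommGroup V] [Module k V] [AddCommGroup W] [Module k W]

/-- The map `m ⊗ w ↦ f(w) m`. -/
noncomputable def sliceRight (f : W →ₗ[k] k) : M ⊗[k] W →ₗ[k] M :=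
  (TensorProduct.rid k M).toLinearMap ∘ₗ f.lTensor M

/-- The map `m ⊗ w ↦ g(m) w`. -/
noncomputable def sliceLeft (g : M →ₗ[k] k) : M ⊗[k] W →ₗ[k] W :=
  (TensorProduct.lid k W).toLinearMap ∘ₗ g.rTensor W

@[simp] theorem sliceRight_tmul (f : W →ₗ[k] k) (m : M) (w : W) :
    sliceRight f (m ⊗ₜ w) = f w • m := by simp [sliceRight]

@[simp] theorem sliceLeft_tmul (g : M →ₗ[k] k) (m : M) (w : W) :
    sliceLeft g (m ⊗ₜ w) = g m • w := by simp [sliceLeft]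

theorem sliceRight_map (f : W →ₗ[k] k) (a : M →ₗ[k] N) (b : V →ₗ[k] W) (z : M ⊗[k] V) :
    sliceRight f (TensorProduct.map a b z) = a (sliceRight (f ∘ₗ b) z) := by
  induction z with
  | zero => simp
  | add y z hy hz => simp only [map_add, hy, hz]
  | tmul m v => simp

theorem sliceLeft_map (g : N →ₗ[k] k) (a : M →ₗ[k] N) (b : V →ₗ[k] W) (z : M ⊗[k] V) :
    sliceLeft g (TensorProduct.map a b z) = b (sliceLeft (g ∘ₗ a) z) := by
  induction z with
  | zero => simp
  | add y z hy hz => simp only [map_add, hy, hz]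
  | tmul m v => simp

theorem apply_sliceRight (f : W →ₗ[k] k) (g : M →ₗ[k] k) (z : M ⊗[k] W) :
    g (sliceRight f z) = f (sliceLeft g z) := by
  induction z with
  | zero => simp
  | add y z hy hz => simp only [map_add, hy, hz]
  | tmul m v => simp [mul_comm]

theorem eq_of_sliceRight {z z' : M ⊗[k] W}
    (h : ∀ f : W →ₗ[k] k, sliceRight f z = sliceRight f z') : z = z' := by
  classical
  let b := Module.Free.chooseBasis k W
  apply (TensorProduct.equivFinsuppOfBasisRight (M := M) b).injective
  ext i
  rw [TensorProduct.equivFinsuppOfBasisRight_apply, TensorProduct.equivFinsuppOfBasisRight_apply]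
  exact h (b.coord i)

theorem eq_of_sliceLeft {z z' : M ⊗[k] W}
    (h : ∀ g : M →ₗ[k] k, sliceLeft g z = sliceLeft g z') : z = z' := by
  classical
  let b := Module.Free.chooseBasis k M
  apply (TensorProduct.equivFinsuppOfBasisLeft (N := W) b).injective
  ext i
  rw [TensorProduct.equivFinsuppOfBasisLeft_apply, TensorProduct.equivFinsuppOfBasisLeft_apply]
  exact h (b.coord i)

theorem mem_range_rTensor_subtype_iff {N : Submodule k M} {z : M ⊗[k] W} :
    z ∈ LinearMap.range (N.subtype.rTensor W) ↔ ∀ f : W →ₗ[k] k, sliceRight f z ∈ N := by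
  constructor
  · rintro ⟨y, rfl⟩ f
    rw [LinearMap.rTensor, sliceRight_map]
    exact (sliceRight _ y).2
  · intro h
    have hex := rTensor_exact W (LinearMap.exact_subtype_mkQ N) N.mkQ_surjective
    refine (hex z).mp (eq_of_sliceRight fun f => ?_)
    rw [LinearMap.rTensor, sliceRight_map, map_zero]
    exact (Submodule.Quotient.mk_eq_zero N).mpr (h f)

theorem mem_range_lTensor_subtype_iff {N : Submodule k W} {z : M ⊗[k] W} :
    z ∈ LinearMap.range (N.subtype.lTensor M) ↔ ∀ g : M →ₗ[k] k, sliceLeft g z ∈ N := by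
  constructor
  · rintro ⟨y, rfl⟩ f
    rw [LinearMap.lTensor, sliceLeft_map]
    exact (sliceLeft _ y).2
  · intro h
    have hex := lTensor_exact M (LinearMap.exact_subtype_mkQ N) N.mkQ_surjective
    refine (hex z).mp (eq_of_sliceLeft fun f => ?_)
    rw [LinearMap.lTensor, sliceLeft_map, map_zero]
    exact (Submodule.Quotient.mk_eq_zero N).mpr (h f)

/-- Over a field `(N ⊗ W) ∩ (M ⊗ U) = N ⊗ U`, because forms on `N` extend to `M`. -/
theorem mem_range_map_subtype_iff {N : Submodule k M} {U : Submodule k W} {z : M ⊗[k] W} :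
    z ∈ LinearMap.range (TensorProduct.map N.subtype U.subtype) ↔
      (∀ f : W →ₗ[k] k, sliceRight f z ∈ N) ∧ ∀ g : M →ₗ[k] k, sliceLeft g z ∈ U := by
  constructor
  · rintro ⟨y, rfl⟩
    refine ⟨fun f => ?_, fun g => ?_⟩
    · rw [sliceRight_map]
      exact (sliceRight _ y).2
    · rw [sliceLeft_map]
      exact (sliceLeft _ y).2
  · rintro ⟨h1, h2⟩
    obtain ⟨y, rfl⟩ := mem_range_rTensor_subtype_iff.mpr h1
    have : y ∈ LinearMap.range (U.subtype.lTensor N) := by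
      rw [mem_range_lTensor_subtype_iff]
      intro g
      obtain ⟨g', rfl⟩ := LinearMap.exists_extend g
      have := h2 g'
      rwa [LinearMap.rTensor, sliceLeft_map] at this
    obtain ⟨y, rfl⟩ := this
    refine ⟨y, ?_⟩
    rw [← LinearMap.comp_apply, LinearMap.rTensor_comp_lTensor]

end Contractions

/-! ### Complements of subcoalgebras -/

section Subcoalgebras

variable {k : Type*} [Field k] {H : Type*} [AddCommGroup H] [Module k H] [Coalgebra k H]

theorem isSubcoalgebra_iff {C : Submodule k H} : IsSubcoalgebra C ↔ ∀ c ∈ C,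
    (∀ f : H →ₗ[k] k, sliceRight f (Coalgebra.comul (R := k) c) ∈ C) ∧
      ∀ f : H →ₗ[k] k, sliceLeft f (Coalgebra.comul (R := k) c) ∈ C :=
  forall₂_congr fun _ _ => mem_range_map_subtype_iff

theorem isSubcoalgebra_bot : IsSubcoalgebra (⊥ : Submodule k H) := by
  rw [isSubcoalgebra_iff]
  rintro c hc
  rw [Submodule.mem_bot] at hc
  simp [hc]

theorem IsSubcoalgebra.inf {C D : Submodule k H} (hC : IsSubcoalgebra C) (hD : IsSubcoalgebra D) :
    IsSubcoalgebra (C ⊓ D) := by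
  rw [isSubcoalgebra_iff] at *
  exact fun c hc => ⟨fun f => ⟨(hC c hc.1).1 f, (hD c hc.2).1 f⟩,
    fun f => ⟨(hC c hc.1).2 f, (hD c hc.2).2 f⟩⟩

theorem IsSubcoalgebra.sup {C D : Submodule k H} (hC : IsSubcoalgebra C) (hD : IsSubcoalgebra D) :
    IsSubcoalgebra (C ⊔ D) := by
  rw [isSubcoalgebra_iff] at *
  intro c hc
  obtain ⟨a, ha, b, hb, rfl⟩ := Submodule.mem_sup.mp hc
  simp only [map_add]
  exact ⟨fun f => Submodule.add_mem_sup ((hC a ha).1 f) ((hD b hb).1 f),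
    fun f => Submodule.add_mem_sup ((hC a ha).2 f) ((hD b hb).2 f)⟩

theorem comul_eq_zero {c : H} (h : Coalgebra.comul (R := k) c = 0) : c = 0 := by
  have := Coalgebra.lTensor_counit_comul (R := k) c
  rw [h, map_zero] at this
  simpa using (congrArg (TensorProduct.rid k H) this).symm

/-- In a sum of simple subcoalgebras every subcoalgebra has a complement. -/
theorem exists_isSubcoalgebra_disjoint [FiniteDimensional k H] {ι : Type*}
    {Ci : ι → Subcoalgebra k H} (hCi : ∀ i, (Ci i).IsSimple) {E : Submodule k H}
    (hE : IsSubcoalgebra E) :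
    ∃ E' : Submodule k H, IsSubcoalgebra E' ∧ Disjoint E E' ∧ ⨆ i, (Ci i).toSubmodule ≤ E ⊔ E' := by
  -- `E'` is maximal among the subcoalgebras disjoint from `E`. A simple `Ci i` meeting `E ⊔ E'`
  -- trivially could be added to it.
  obtain ⟨E', ⟨hE', hd⟩, hmax⟩ := (set_has_maximal_iff_noetherian (R := k) (M := H)).mpr inferInstance
    {D : Submodule k H | IsSubcoalgebra D ∧ Disjoint E D} ⟨⊥, isSubcoalgebra_bot, disjoint_bot_right⟩
  refine ⟨E', hE', hd, iSup_le fun i => ?_⟩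
  have hi := (Ci i).isSubcoalgebra
  rcases (hCi i).2 ⟨(Ci i).toSubmodule ⊓ (E ⊔ E'), hi.inf (hE.sup hE')⟩ inf_le_left with h | h
  · exfalso
    have hdis : Disjoint E (E' ⊔ (Ci i).toSubmodule) :=
      hd.disjoint_sup_right_of_disjoint_sup_left (disjoint_iff.mpr ((inf_comm _ _).trans h))
    refine hmax _ ⟨hE'.sup hi, hdis⟩ (lt_of_le_of_ne le_sup_left fun heq => (hCi i).1 ?_)
    have h2 : (Ci i).toSubmodule ≤ E' := heq ▸ le_sup_right
    rw [← h, eq_comm, inf_eq_left]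
    exact h2.trans le_sup_right
  · exact inf_eq_left.mp h

end Subcoalgebras

/-! ### Stability of subcoalgebras under a primitive element -/

section PrimitiveElements

variable {k : Type*} [Field k] {H : Type*} [Ring H] [Bialgebra k H] {x : H}

theorem IsPrimitiveElement.comul_mul (hx : IsPrimitiveElement k x) (c : H) :
    Coalgebra.comul (R := k) (x * c) =
      tensorSum (LinearMap.mulLeft k x) (LinearMap.mulLeft k x) (Coalgebra.comul c) := by
  rw [Bialgebra.comul_mul, hx]
  generalize Coalgebra.comul (R := k) c = z
  induction z with
  | zero => simp
  | add a b ha hb => rw [mul_add, ha, hb, map_add]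
  | tmul a b => simp [tensorSum_tmul, add_mul]

/-- If `x` preserves a sum of simple subcoalgebras, then it preserves each of its
subcoalgebras. -/
theorem IsPrimitiveElement.mul_mem_of_isSubcoalgebra [FiniteDimensional k H]
    (hx : IsPrimitiveElement k x) {ι : Type*} {Ci : ι → Subcoalgebra k H}
    (hCi : ∀ i, (Ci i).IsSimple)
    (hxC : ∀ c ∈ ⨆ i, (Ci i).toSubmodule, x * c ∈ ⨆ i, (Ci i).toSubmodule)
    {E : Submodule k H} (hE : IsSubcoalgebra E) (hEC : E ≤ ⨆ i, (Ci i).toSubmodule)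
    {c : H} (hc : c ∈ E) : x * c ∈ E := by
  obtain ⟨E', hE', hd, hle⟩ := exists_isSubcoalgebra_disjoint hCi hE
  obtain ⟨a, ha, b, hb, hab⟩ := Submodule.mem_sup.mp (hle (hxC c (hEC hc)))
  have hkill : ∀ e ∈ E, E.mkQ e = 0 := fun e he => (Submodule.Quotient.mk_eq_zero E).mpr he
  -- `Δ(x c) = (x ⊗ 1 + 1 ⊗ x) Δ(c)` lies in `H ⊗ E + E ⊗ H`, so it dies in `H/E ⊗ H/E`. The
  -- component `b` in `E'` then has zero comultiplication, since `E'` embeds in `H/E`.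
  have h1 : TensorProduct.map E.mkQ E.mkQ (Coalgebra.comul (R := k) (x * c)) = 0 := by
    rw [hx.comul_mul]
    obtain ⟨y, hy⟩ := hE c hc
    rw [← hy]
    clear hy
    induction y with
    | zero => simp
    | add y z hy hz => simp only [map_add, hy, hz, add_zero]
    | tmul u v => simp [tensorSum_tmul, hkill]
  have h2 : TensorProduct.map E.mkQ E.mkQ (Coalgebra.comul (R := k) a) = 0 := by
    obtain ⟨y, hy⟩ := hE a ha
    rw [← hy]
    clear hy
    induction y with
    | zero => simp
    | add y z hy hz => simp only [map_add, hy, hz, add_zero]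
    | tmul u v => simp [hkill]
  have h3 : TensorProduct.map E.mkQ E.mkQ (Coalgebra.comul (R := k) b) = 0 := by
    rw [← hab, map_add, map_add, h2, zero_add] at h1
    exact h1
  obtain ⟨y, hy⟩ := hE' b hb
  have hinj : Function.Injective (E.mkQ ∘ₗ E'.subtype) := by
    rw [← LinearMap.ker_eq_bot, LinearMap.ker_eq_bot']
    intro e he
    exact Subtype.ext (Submodule.disjoint_def.mp hd e
      ((Submodule.Quotient.mk_eq_zero E).mp he) e.2)
  have hy0 : y = 0 := by
    apply TensorProduct.map_injective_of_flat_flat _ _ hinj hinj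
    rw [TensorProduct.map_comp, LinearMap.comp_apply, hy, h3, map_zero]
  have hb0 : b = 0 := comul_eq_zero (k := k) (by rw [← hy, hy0, map_zero])
  rw [← hab, hb0, add_zero]
  exact ha

end PrimitiveElements

/-! ### Burnside's theorem -/

section Burnside

variable {k : Type*} [Field k] [IsAlgClosed k] {M : Type*} [AddCommGroup M] [Module k M]
  [FiniteDimensional k M]

/-- Burnside's theorem on irreducible algebras of endomorphisms. -/
theorem subalgebra_end_eq_top [Nontrivial M] (R : Subalgebra k (Module.End k M))
    (hR : ∀ N : Submodule k M, (∀ a ∈ R, ∀ n ∈ N, a n ∈ N) → N = ⊥ ∨ N = ⊤) : R = ⊤ := by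
  have : IsSimpleModule R M := by
    rw [isSimpleModule_iff]
    refine { eq_bot_or_eq_top := fun N => ?_ }
    rcases hR (N.restrictScalars k) fun a ha n hn => N.smul_mem ⟨a, ha⟩ hn with h | h
    · exact Or.inl ((Submodule.restrictScalars_eq_bot_iff ..).mp h)
    · exact Or.inr ((Submodule.restrictScalars_eq_top_iff ..).mp h)
  rw [eq_top_iff]
  intro f _
  have hs := (IsSimpleModule.algebraMap_end_bijective_of_isAlgClosed (A := R) (V := M) k).2
  -- By Schur's lemma the commutant of `R` consists of scalars, so every `k`-linear `f` commutes
  -- with it, and the density theorem realizes `f` on a basis by an element of `R`.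
  let F : Module.End (Module.End R M) M :=
    { f with
      map_smul' := fun s m => by
        obtain ⟨c, rfl⟩ := hs s
        exact f.map_smul c m }
  let b := Module.finBasis k M
  classical
  obtain ⟨r, hr⟩ := jacobson_density F (Finset.univ.image b)
  have : (r : Module.End k M) = f :=
    b.ext fun i => (hr (b i) (Finset.mem_image_of_mem _ (Finset.mem_univ i))).symm
  exact this ▸ r.2

end Burnside

/-! ### The dual action and the coefficients of a comodule -/

namespace RightComodule

variable {k : Type*} [Field k] {H : Type*} [AddCommGroup H] [Module k H] [Coalgebra k H]
  {M : Type*} [AddCommGroup M] [Module k M] (ρ : RightComodule k H M)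

/-- The action `f ⋅ m = f(m₁) m₀` of the dual. -/
noncomputable def dualAct : (H →ₗ[k] k) →ₗ[k] Module.End k M where
  toFun f := sliceRight f ∘ₗ ρ.coact
  map_add' f g := by
    ext m
    simp [sliceRight, LinearMap.lTensor_add]
  map_smul' a f := by
    ext m
    simp [sliceRight, LinearMap.lTensor_smul]

theorem dualAct_apply (f : H →ₗ[k] k) (m : M) : ρ.dualAct f m = sliceRight f (ρ.coact m) := rfl

theorem dualAct_counit : ρ.dualAct Coalgebra.counit = 1 := by
  ext m
  have := LinearMap.congr_fun ρ.counit_coact m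
  simp only [LinearMap.comp_apply] at this
  simp [dualAct_apply, sliceRight, this]

/-- The convolution product of linear forms. -/
noncomputable def conv (f g : H →ₗ[k] k) : H →ₗ[k] k :=
  LinearMap.mul' k k ∘ₗ TensorProduct.map f g ∘ₗ Coalgebra.comul

theorem sliceRight_conv (f g : H →ₗ[k] k) (z : M ⊗[k] H) :
    sliceRight (conv f g) z = sliceRight f (sliceRight g
      ((TensorProduct.assoc k M H H).symm (Coalgebra.comul.lTensor M z))) := by
  induction z with
  | zero => simp
  | add y z hy hz => simp only [map_add, hy, hz]
  | tmul m h =>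
    rw [LinearMap.lTensor_tmul, sliceRight_tmul]
    change LinearMap.mul' k k (TensorProduct.map f g (Coalgebra.comul h)) • m = _
    generalize Coalgebra.comul (R := k) h = y
    induction y with
    | zero => simp
    | add y z hy hz => simp only [map_add, hy, hz, TensorProduct.tmul_add, add_smul]
    | tmul a b => simp [mul_smul, smul_comm (f a)]

theorem coassoc_symm_apply (m : M) :
    (TensorProduct.assoc k M H H).symm (Coalgebra.comul.lTensor M (ρ.coact m)) =
      ρ.coact.rTensor H (ρ.coact m) := by
  rw [LinearEquiv.symm_apply_eq]
  exact (LinearMap.congr_fun ρ.coassoc m).symm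

theorem dualAct_conv (f g : H →ₗ[k] k) : ρ.dualAct (conv f g) = ρ.dualAct f * ρ.dualAct g := by
  ext m
  rw [dualAct_apply, sliceRight_conv, coassoc_symm_apply, LinearMap.rTensor, sliceRight_map]
  rfl

/-- The image of the dual in the endomorphisms. -/
noncomputable def dualImage : Subalgebra k (Module.End k M) where
  __ := LinearMap.range ρ.dualAct
  mul_mem' := by
    rintro _ _ ⟨f, rfl⟩ ⟨g, rfl⟩
    exact ⟨conv f g, ρ.dualAct_conv f g⟩
  algebraMap_mem' r := ⟨r • Coalgebra.counit, by
    rw [map_smul, dualAct_counit, Algebra.algebraMap_eq_smul_one]⟩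

/-- Nonzero, without proper nonzero subspaces stable under the dual. -/
structure IsIrreducible : Prop where
  nontrivial : Nontrivial M
  eq_bot_or_eq_top : ∀ N : Submodule k M, (∀ (f : H →ₗ[k] k), ∀ n ∈ N, ρ.dualAct f n ∈ N) →
    N = ⊥ ∨ N = ⊤

variable {ρ}

/-- The orbit of a nonzero vector under the dual of `H` is stable and nonzero, hence everything. -/
theorem IsIrreducible.finiteDimensional [FiniteDimensional k H] (h : ρ.IsIrreducible) :
    FiniteDimensional k M := by
  have := h.nontrivial
  obtain ⟨m, hm⟩ := exists_ne (0 : M)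
  have hN := h.eq_bot_or_eq_top (LinearMap.range ((LinearMap.applyₗ m) ∘ₗ ρ.dualAct)) (by
    rintro f _ ⟨g, rfl⟩
    exact ⟨conv f g, by simp [dualAct_conv]⟩)
  have hmem : m ∈ LinearMap.range ((LinearMap.applyₗ m) ∘ₗ ρ.dualAct) :=
    ⟨Coalgebra.counit, by simp [dualAct_counit]⟩
  rcases hN with h0 | h0
  · rw [h0, Submodule.mem_bot] at hmem
    exact absurd hmem hm
  · exact Module.Finite.of_surjective _ (LinearMap.range_eq_top.mp h0)

theorem IsIrreducible.dualAct_surjective [IsAlgClosed k] [FiniteDimensional k M]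
    (h : ρ.IsIrreducible) : Function.Surjective ρ.dualAct := by
  have := h.nontrivial
  have htop : ρ.dualImage = ⊤ := subalgebra_end_eq_top _ fun N hN =>
    h.eq_bot_or_eq_top N fun f => hN _ ⟨f, rfl⟩
  intro a
  exact (htop ▸ Algebra.mem_top : a ∈ ρ.dualImage)

variable (ρ)

/-- The span of the coefficients `g(m₀) m₁`. -/
noncomputable def coeffSpan : Submodule k H :=
  Submodule.span k {c | ∃ (g : M →ₗ[k] k) (m : M), sliceLeft g (ρ.coact m) = c}

theorem sliceLeft_mem_coeffSpan (g : M →ₗ[k] k) (m : M) :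
    sliceLeft g (ρ.coact m) ∈ ρ.coeffSpan := Submodule.subset_span ⟨g, m, rfl⟩

theorem coeffSpan_le {C : Submodule k H}
    (h : ∀ (g : M →ₗ[k] k) (m : M), sliceLeft g (ρ.coact m) ∈ C) : ρ.coeffSpan ≤ C := by
  rw [coeffSpan, Submodule.span_le]
  rintro _ ⟨g, m, rfl⟩
  exact h g m

/-- This is `g(f ⋅ m) = f(g(m₀) m₁)`: the kernel of the action is the annihilator of the
coefficients. -/
theorem dualAct_eq_zero_iff {f : H →ₗ[k] k} : ρ.dualAct f = 0 ↔ ∀ c ∈ ρ.coeffSpan, f c = 0 := by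
  constructor
  · intro h
    have : ρ.coeffSpan ≤ LinearMap.ker f := ρ.coeffSpan_le fun g m => by
      rw [LinearMap.mem_ker, ← apply_sliceRight, ← dualAct_apply, h]
      simp
    exact this
  · intro h
    ext m
    refine (Module.forall_dual_apply_eq_zero_iff k _).mp fun g => ?_
    rw [dualAct_apply, apply_sliceRight]
    exact h _ (ρ.sliceLeft_mem_coeffSpan g m)

/-- By coassociativity, contracting `Δ` of the coefficient of `(g, m)` with `f` gives the
coefficient of `(g, f ⋅ m)` on one side and of `(g ∘ f, m)` on the other, with `f` acting through
`dualAct`. -/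
theorem isSubcoalgebra_coeffSpan : IsSubcoalgebra ρ.coeffSpan := by
  rw [isSubcoalgebra_iff]
  have h1 : ∀ (g : M →ₗ[k] k) (f : H →ₗ[k] k) (z : M ⊗[k] H),
      sliceRight f (Coalgebra.comul (R := k) (sliceLeft g z)) = sliceLeft g (sliceRight f
        ((TensorProduct.assoc k M H H).symm (Coalgebra.comul.lTensor M z))) := by
    intro g f z
    induction z with
    | zero => simp
    | add y z hy hz => simp only [map_add, hy, hz]
    | tmul m h =>
      rw [LinearMap.lTensor_tmul, sliceLeft_tmul, map_smul, map_smul]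
      generalize Coalgebra.comul (R := k) h = y
      induction y with
      | zero => simp
      | add y z hy hz => simp only [map_add, hy, hz, TensorProduct.tmul_add, smul_add]
      | tmul a b => simp [smul_smul, mul_comm]
  have h2 : ∀ (g : M →ₗ[k] k) (f : H →ₗ[k] k) (z : M ⊗[k] H),
      sliceLeft f (Coalgebra.comul (R := k) (sliceLeft g z)) =
        sliceLeft g ((sliceRight f).rTensor H
        ((TensorProduct.assoc k M H H).symm (Coalgebra.comul.lTensor M z))) := by
    intro g f z
    induction z with
    | zero => simp
    | add y z hy hz => simp only [map_add, hy, hz]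
    | tmul m h =>
      rw [LinearMap.lTensor_tmul, sliceLeft_tmul, map_smul, map_smul]
      generalize Coalgebra.comul (R := k) h = y
      induction y with
      | zero => simp
      | add y z hy hz => simp only [map_add, hy, hz, TensorProduct.tmul_add, smul_add]
      | tmul a b => simp [smul_smul, mul_comm]
  intro c hc
  induction hc using Submodule.span_induction with
  | mem c hc =>
    obtain ⟨g, m, rfl⟩ := hc
    refine ⟨fun f => ?_, fun f => ?_⟩
    · rw [h1, coassoc_symm_apply, LinearMap.rTensor, sliceRight_map]
      exact ρ.sliceLeft_mem_coeffSpan _ _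
    · rw [h2, coassoc_symm_apply, ← LinearMap.comp_apply ((sliceRight f).rTensor H),
        ← LinearMap.rTensor_comp, LinearMap.rTensor, sliceLeft_map]
      exact ρ.sliceLeft_mem_coeffSpan _ _
  | zero => simp
  | add a b _ _ ha hb =>
    simp only [map_add]
    exact ⟨fun f => add_mem (ha.1 f) (hb.1 f), fun f => add_mem (ha.2 f) (hb.2 f)⟩
  | smul r a _ ha =>
    simp only [map_smul]
    exact ⟨fun f => Submodule.smul_mem _ r (ha.1 f), fun f => Submodule.smul_mem _ r (ha.2 f)⟩

theorem coeffSpan_ne_bot [Nontrivial M] : ρ.coeffSpan ≠ ⊥ := by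
  intro h
  have := (ρ.dualAct_eq_zero_iff (f := Coalgebra.counit)).mpr (by simp [h])
  rw [dualAct_counit] at this
  exact one_ne_zero this

variable {ρ}

/-- The dual of `H` modulo the annihilator of the coefficients is `End M`. -/
theorem IsIrreducible.finrank_coeffSpan [IsAlgClosed k] [FiniteDimensional k H]
    (h : ρ.IsIrreducible) : Module.finrank k ρ.coeffSpan = Module.finrank k M ^ 2 := by
  have := h.finiteDimensional
  have hker : LinearMap.ker ρ.dualAct = ρ.coeffSpan.dualAnnihilator := by
    ext f
    rw [LinearMap.mem_ker, dualAct_eq_zero_iff, Submodule.mem_dualAnnihilator]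
  have h1 := LinearMap.finrank_range_add_finrank_ker ρ.dualAct
  rw [LinearMap.range_eq_top.mpr h.dualAct_surjective, finrank_top, hker,
    Module.finrank_linearMap, Module.finrank_linearMap_self] at h1
  have h2 := Subspace.finrank_add_finrank_dualAnnihilator_eq ρ.coeffSpan
  have h3 : Module.finrank k M * Module.finrank k M +
    Module.finrank k ρ.coeffSpan.dualAnnihilator = Module.finrank k H := h1
  rw [pow_two]
  omega

end RightComodule

/-! ### Lifting a primitive element to an irreducible comodule -/

namespace RightComodule

variable {k : Type*} [Field k] {H : Type*} [Ring H] [Bialgebra k H] {x : H}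
  {M : Type*} [AddCommGroup M] [Module k M] {ρ : RightComodule k H M}

theorem sliceRight_tensorSum {W : Type*} [AddCommGroup W] [Module k W] (f : W →ₗ[k] k)
    (A : Module.End k M) (B : Module.End k W) (z : M ⊗[k] W) :
    sliceRight f (tensorSum A B z) = A (sliceRight f z) + sliceRight (f ∘ₗ B) z := by
  induction z with
  | zero => simp
  | add y z hy hz => simp only [map_add, hy, hz]; abel
  | tmul m w => simp [tensorSum_tmul]

theorem conv_comp_mulLeft (hx : IsPrimitiveElement k x) (f g : H →ₗ[k] k) :
    conv f g ∘ₗ LinearMap.mulLeft k x =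
      conv (f ∘ₗ LinearMap.mulLeft k x) g + conv f (g ∘ₗ LinearMap.mulLeft k x) := by
  ext c
  change LinearMap.mul' k k (TensorProduct.map f g (Coalgebra.comul (x * c))) =
    LinearMap.mul' k k (TensorProduct.map (f ∘ₗ LinearMap.mulLeft k x) g (Coalgebra.comul c)) +
    LinearMap.mul' k k (TensorProduct.map f (g ∘ₗ LinearMap.mulLeft k x) (Coalgebra.comul c))
  rw [hx.comul_mul]
  generalize Coalgebra.comul (R := k) c = z
  induction z with
  | zero => simp
  | add y z hy hz => simp only [map_add, hy, hz]; abel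
  | tmul a b => simp [tensorSum_tmul]

/-- On an irreducible comodule whose coefficients are stable under `x`, the derivation of the dual
induced by `x` is inner. -/
theorem IsIrreducible.exists_coact_eq_tensorSum [IsAlgClosed k] [FiniteDimensional k H]
    (h : ρ.IsIrreducible) (hx : IsPrimitiveElement k x)
    (hxρ : ∀ c ∈ ρ.coeffSpan, x * c ∈ ρ.coeffSpan) :
    ∃ A : Module.End k M,
      ∀ m, ρ.coact (A m) = tensorSum A (LinearMap.mulLeft k x) (ρ.coact m) := by
  have := h.finiteDimensional
  have := h.nontrivial
  -- A linear section of the action. The derivation is `δ(a) = dualAct (e a ∘ x)`; another choice of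
  -- preimage gives the same value, since stability of the coefficients under `x` keeps the kernel
  -- of `dualAct` stable.
  obtain ⟨e, he⟩ := ρ.dualAct.exists_rightInverse_of_surjective
    (LinearMap.range_eq_top.mpr h.dualAct_surjective)
  have he' : ∀ a, ρ.dualAct (e a) = a := fun a => LinearMap.congr_fun he a
  obtain ⟨v₀, hv₀⟩ := exists_ne (0 : M)
  obtain ⟨g₀, hg₀⟩ : ∃ g : M →ₗ[k] k, g v₀ = 1 := by
    obtain ⟨g, hg⟩ := not_forall.mp (mt (Module.forall_dual_apply_eq_zero_iff k v₀).mp hv₀)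
    exact ⟨(g v₀)⁻¹ • g, by simp [inv_mul_cancel₀ hg]⟩
  let S : M →ₗ[k] Module.End k M := LinearMap.smulRightₗ g₀
  have hS : ∀ v w, S v w = g₀ w • v := fun v w => by simp [S]
  -- With `S v` the rank one operator sending `v₀` to `v`, put `T v = δ(S v) v₀`. The Leibniz rule
  -- for `δ(f ∘ S v)` at `v₀` reads `T f = δ(f) + f T`, so `δ` is the commutator with `T`.
  let T : Module.End k M := LinearMap.applyₗ v₀ ∘ₗ ρ.dualAct ∘ₗ
    LinearMap.lcomp k k (LinearMap.mulLeft k x) ∘ₗ e ∘ₗ S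
  have hT : ∀ v, T v = ρ.dualAct (e (S v) ∘ₗ LinearMap.mulLeft k x) v₀ := fun v => rfl
  have key : ∀ f v, T (ρ.dualAct f v) =
      ρ.dualAct (f ∘ₗ LinearMap.mulLeft k x) v + ρ.dualAct f (T v) := by
    intro f v
    have h1 : ρ.dualAct (e (S (ρ.dualAct f v)) - conv f (e (S v))) = 0 := by
      rw [map_sub, dualAct_conv, he', he', sub_eq_zero]
      ext w
      simp [hS]
    have h2 : ρ.dualAct ((e (S (ρ.dualAct f v)) - conv f (e (S v))) ∘ₗ
        LinearMap.mulLeft k x) = 0 := by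
      rw [dualAct_eq_zero_iff] at h1 ⊢
      exact fun c hc => h1 _ (hxρ c hc)
    rw [LinearMap.sub_comp, map_sub, sub_eq_zero, conv_comp_mulLeft hx, map_add, dualAct_conv,
      dualAct_conv, he'] at h2
    rw [hT, hT, h2]
    simp [hS, hg₀]
  refine ⟨-T, fun m => eq_of_sliceRight fun f => ?_⟩
  rw [sliceRight_tensorSum, ← dualAct_apply, ← dualAct_apply, ← dualAct_apply, LinearMap.neg_apply,
    LinearMap.neg_apply, map_neg, key]
  abel

/-- Additivity and `P(x) = 0` give `ρ(P(A) m) = (P(A) ⊗ 1) ρ(m)`, so an eigenspace of `P(A)` is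
stable and `P(A)` is a scalar `c`. Replacing `A` by `A + b` preserves the compatibility and adds
`P(b)`, which is chosen to be `-c`. -/
theorem IsIrreducible.exists_aeval_eq_zero [IsAlgClosed k] [FiniteDimensional k H]
    (h : ρ.IsIrreducible) (hx : IsPrimitiveElement k x)
    (hxρ : ∀ c ∈ ρ.coeffSpan, x * c ∈ ρ.coeffSpan) :
    ∃ A : Module.End k M, aeval A (minpoly k x) = 0 ∧
      ∀ m, ρ.coact (A m) = tensorSum A (LinearMap.mulLeft k x) (ρ.coact m) := by
  have := h.finiteDimensional
  have := h.nontrivial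
  obtain ⟨A, hA⟩ := h.exists_coact_eq_tensorSum hx hxρ
  set P := minpoly k x with hPdef
  have hP : P.IsAdditive := hx.isAdditive_minpoly
  have hint : IsIntegral k x := Algebra.IsIntegral.isIntegral x
  have : Nontrivial H := by
    obtain ⟨c, -, hc⟩ := (Submodule.ne_bot_iff _).mp ρ.coeffSpan_ne_bot
    exact nontrivial_of_ne c 0 hc
  have hL : aeval (LinearMap.mulLeft k x) P = 0 := by
    have h1 : aeval (LinearMap.mulLeft k x) P = LinearMap.mulLeft k (aeval x P) :=
      aeval_algHom_apply (Algebra.lmul k H) x P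
    rw [h1, minpoly.aeval, LinearMap.mulLeft_zero_eq_zero]
  have hpow : ∀ (Q : k[X]) (m : M), ρ.coact (aeval A Q m) =
      aeval (tensorSum A (LinearMap.mulLeft k x)) Q (ρ.coact m) := by
    intro Q
    induction Q using Polynomial.induction_on with
    | C a => intro m; simp [Algebra.algebraMap_eq_smul_one]
    | add p q hp hq => intro m; simp only [map_add, LinearMap.add_apply, hp, hq]
    | monomial n a ih =>
      intro m
      rw [pow_succ, ← mul_assoc, map_mul _ _ X, map_mul _ _ X, aeval_X, aeval_X,
        Module.End.mul_apply, Module.End.mul_apply, ih, hA]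
  have hcomm : ∀ f m, ρ.dualAct f (aeval A P m) = aeval A P (ρ.dualAct f m) := by
    intro f m
    have h1 := hpow P m
    rw [tensorSum, hP.aeval_add (commute_rTensor_lTensor _ _), aeval_rTensor, aeval_lTensor, hL,
      LinearMap.lTensor_zero, add_zero] at h1
    rw [dualAct_apply, h1, LinearMap.rTensor, sliceRight_map]
    rfl
  obtain ⟨c, hc⟩ := Module.End.exists_eigenvalue (aeval A P)
  have hscalar : ∀ m, aeval A P m = c • m := by
    rcases h.eq_bot_or_eq_top ((aeval A P).eigenspace c) (by
      intro f n hn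
      rw [Module.End.mem_eigenspace_iff] at hn ⊢
      rw [← hcomm, hn, map_smul]) with h0 | h0
    · exact absurd h0 hc
    · exact fun m => Module.End.mem_eigenspace_iff.mp (h0 ▸ Submodule.mem_top)
  obtain ⟨b, hb⟩ : ∃ b, P.eval b = -c := by
    obtain ⟨b, hb⟩ := IsAlgClosed.exists_root (P + C c) (by
      have hd := minpoly.degree_pos hint
      rw [degree_add_C hd]
      exact hd.ne')
    refine ⟨b, ?_⟩
    rw [IsRoot, eval_add, eval_C] at hb
    exact eq_neg_of_add_eq_zero_left hb
  refine ⟨A + algebraMap k _ b, ?_, fun m => ?_⟩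
  · rw [hP.aeval_add (Algebra.commutes b A).symm, aeval_algebraMap_apply, coe_aeval_eq_eval, hb]
    ext m
    simp [hscalar]
  · rw [LinearMap.add_apply, map_add, hA, Module.algebraMap_end_apply, map_smul]
    have : tensorSum (A + algebraMap k _ b) (LinearMap.mulLeft k x) =
        tensorSum A (LinearMap.mulLeft k x) + algebraMap k (Module.End k (M ⊗[k] H)) b := by
      ext m h
      simp [tensorSum_tmul, TensorProduct.add_tmul, TensorProduct.smul_tmul']
      abel
    rw [this, LinearMap.add_apply, Module.algebraMap_end_apply]

/-- The comodule structure on a subcomodule. -/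
theorem exists_restrict {C : Type*} [AddCommGroup C] [Module k C] [Coalgebra k C]
    (ρ : RightComodule k C M) {N : Submodule k M} (hN : ρ.IsSubcomodule N) :
    ∃ σ : RightComodule k C N, N.subtype.rTensor C ∘ₗ σ.coact = ρ.coact ∘ₗ N.subtype := by
  have hi : Function.Injective (N.subtype.rTensor C) :=
    Module.Flat.rTensor_preserves_injective_linearMap _ N.injective_subtype
  obtain ⟨d, hd⟩ : ∃ d : N →ₗ[k] N ⊗[k] C, N.subtype.rTensor C ∘ₗ d = ρ.coact ∘ₗ N.subtype := by
    let e := LinearEquiv.ofInjective _ hi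
    refine ⟨e.symm.toLinearMap ∘ₗ (ρ.coact ∘ₗ N.subtype).codRestrict _ (fun n => hN n n.2), ?_⟩
    ext n
    exact congrArg Subtype.val (e.apply_symm_apply _)
  refine ⟨⟨d, ?_, ?_⟩, hd⟩
  · have hi' : Function.Injective (N.subtype.rTensor (C ⊗[k] C)) :=
      Module.Flat.rTensor_preserves_injective_linearMap _ N.injective_subtype
    rw [← LinearMap.cancel_left hi']
    have h1 : N.subtype.rTensor (C ⊗[k] C) ∘ₗ (TensorProduct.assoc k N C C).toLinearMap =
        (TensorProduct.assoc k M C C).toLinearMap ∘ₗ (N.subtype.rTensor C).rTensor C := by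
      ext; rfl
    calc _ = (TensorProduct.assoc k M C C).toLinearMap ∘ₗ
          ((N.subtype.rTensor C ∘ₗ d).rTensor C) ∘ₗ d := by
          rw [← LinearMap.comp_assoc, h1, LinearMap.rTensor_comp]
          simp only [LinearMap.comp_assoc]
      _ = (TensorProduct.assoc k M C C).toLinearMap ∘ₗ ρ.coact.rTensor C ∘ₗ
          (N.subtype.rTensor C ∘ₗ d) := by
          rw [hd, LinearMap.rTensor_comp, LinearMap.comp_assoc, hd]
      _ = Coalgebra.comul.lTensor M ∘ₗ N.subtype.rTensor C ∘ₗ d := by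
          have := ρ.coassoc
          rw [hd]
          simp only [← LinearMap.comp_assoc] at this ⊢
          rw [this]
      _ = _ := by
          rw [← LinearMap.comp_assoc, ← LinearMap.comp_assoc, LinearMap.lTensor_comp_rTensor,
            LinearMap.rTensor_comp_lTensor]
  · have hi' : Function.Injective (N.subtype.rTensor k) :=
      Module.Flat.rTensor_preserves_injective_linearMap _ N.injective_subtype
    rw [← LinearMap.cancel_left hi', ← LinearMap.comp_assoc, LinearMap.rTensor_comp_lTensor,
      ← LinearMap.lTensor_comp_rTensor, LinearMap.comp_assoc, hd, ← LinearMap.comp_assoc,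
      ρ.counit_coact]
    ext n
    simp

end RightComodule

/-! ### Simple comodules and simple subcoalgebras -/

section SimpleComodules

variable {k : Type*} [Field k] {H : Type*} [AddCommGroup H] [Module k H] [Coalgebra k H]

theorem Subcoalgebra.exists_comp_subtype (C : Subcoalgebra k H) {V : Type*} [AddCommGroup V]
    [Module k V] (g : C →ₗ[k] V) : ∃ f : H →ₗ[k] V, f ∘ₗ C.subtype = g := by
  obtain ⟨r, hr⟩ := C.subtype.exists_leftInverse_of_injective
    (LinearMap.ker_eq_bot.mpr C.subtype_injective)
  exact ⟨g ∘ₗ r, by rw [LinearMap.comp_assoc, hr, LinearMap.comp_id]⟩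

namespace RightComodule

variable {M : Type*} [AddCommGroup M] [Module k M]

/-- Forms on `C` extend to `H`, so a subspace stable under the dual of `H` is a subcomodule over
`C`. -/
theorem IsSimple.isIrreducible_push {C : Subcoalgebra k H} {ρ : RightComodule k C M}
    (h : ρ.IsSimple) : (ρ.push C.incl).IsIrreducible := by
  refine ⟨h.1, fun N hN => h.2 N fun n hn => mem_range_rTensor_subtype_iff.mpr fun g => ?_⟩
  obtain ⟨f, rfl⟩ := C.exists_comp_subtype g
  have := hN f n hn
  rw [dualAct_apply] at this
  change sliceRight f (C.subtype.lTensor M (ρ.coact n)) ∈ N at this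
  rwa [LinearMap.lTensor, sliceRight_map] at this

theorem coeffSpan_push_le {C : Subcoalgebra k H} (ρ : RightComodule k C M) :
    (ρ.push C.incl).coeffSpan ≤ C.toSubmodule := by
  refine coeffSpan_le _ fun g m => ?_
  change sliceLeft g (C.subtype.lTensor M (ρ.coact m)) ∈ _
  rw [LinearMap.lTensor, sliceLeft_map]
  exact (sliceLeft _ (ρ.coact m)).2

/-- The coefficients of a minimal right coideal of a simple subcoalgebra `C` span `C`. -/
theorem exists_isIrreducible_coeffSpan_eq [FiniteDimensional k H] {C : Subcoalgebra k H}
    (hC : C.IsSimple) : ∃ (N : Submodule k H) (σ : RightComodule k H N),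
      σ.IsIrreducible ∧ σ.coeffSpan = C.toSubmodule := by
  have hCsub := isSubcoalgebra_iff.mp C.isSubcoalgebra
  obtain ⟨N, ⟨hN0, hNC, hN⟩, hmin⟩ := wellFounded_lt.has_min
    {N : Submodule k H | N ≠ ⊥ ∧ N ≤ C.toSubmodule ∧
      ∀ f, ∀ n ∈ N, (regular k H).dualAct f n ∈ N}
    ⟨C.toSubmodule, hC.1, le_rfl, fun f n hn => (hCsub n hn).1 f⟩
  obtain ⟨σ, hσ⟩ := (regular k H).exists_restrict (N := N)
    fun n hn => mem_range_rTensor_subtype_iff.mpr fun f => hN f n hn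
  have hσ' : ∀ n, N.subtype.rTensor H (σ.coact n) = Coalgebra.comul (R := k) (n : H) :=
    fun n => LinearMap.congr_fun hσ n
  have hact : ∀ f n, ((σ.dualAct f n : N) : H) = (regular k H).dualAct f n := by
    intro f n
    change N.subtype (sliceRight f (σ.coact n)) = sliceRight f (Coalgebra.comul (R := k) (n : H))
    rw [← hσ', LinearMap.rTensor, sliceRight_map]
    rfl
  have : Nontrivial N := Submodule.nontrivial_iff_ne_bot.mpr hN0
  refine ⟨N, σ, ⟨this, fun N' hN' => ?_⟩, ?_⟩
  · by_contra hcon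
    rw [not_or] at hcon
    have hle : N'.map N.subtype ≤ N := Submodule.map_subtype_le N N'
    refine hmin (N'.map N.subtype) ⟨?_, hle.trans hNC, ?_⟩ (lt_of_le_of_ne hle fun h => hcon.2 ?_)
    · exact fun h0 => hcon.1 (Submodule.map_injective_of_injective N.injective_subtype
        (h0.trans (Submodule.map_bot _).symm))
    · rintro f _ ⟨n, hn, rfl⟩
      exact ⟨σ.dualAct f n, hN' f n hn, hact f n⟩
    · rw [eq_top_iff]
      intro n _
      obtain ⟨n', hn', he⟩ := h.ge n.2
      rwa [← Subtype.ext he]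
  · refine (hC.2 ⟨σ.coeffSpan, σ.isSubcoalgebra_coeffSpan⟩ (σ.coeffSpan_le fun g n => ?_)
      ).resolve_left σ.coeffSpan_ne_bot
    obtain ⟨g', rfl⟩ := LinearMap.exists_extend g
    have := (hCsub n (hNC n.2)).2 g'
    rwa [← hσ', LinearMap.rTensor, sliceLeft_map] at this

end RightComodule

end SimpleComodules

/-! ### Divisibility of dimensions -/

section Divisibility

variable {k : Type*} [Field k] {H : Type*} [Ring H] [HopfAlgebra k H] [FiniteDimensional k H]
  {x : H}

namespace IsPrimitiveElement

/-- The degree `d` of the minimal polynomial is not `1`, as an additive monic polynomial of degree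
`1` is `X` and `x ≠ 0`. Additivity at `(1, d - 1)` then says `d = 0` in `k`. -/
theorem dvd_finrank_adjoin (hx : IsPrimitiveElement k x) (hx0 : x ≠ 0) (p : ℕ) [CharP k p] :
    p ∣ Module.finrank k (Algebra.adjoin k {x}) := by
  have hint : IsIntegral k x := Algebra.IsIntegral.isIntegral x
  have : Nontrivial H := nontrivial_of_ne x 0 hx0
  have hP := hx.isAdditive_minpoly
  have hm := minpoly.monic hint
  have hpos := minpoly.natDegree_pos hint
  have hne : (minpoly k x).natDegree ≠ 1 := by
    intro h1
    have h2 := minpoly.aeval k x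
    rw [hm.eq_X_add_C h1, hP.coeff_zero] at h2
    exact hx0 (by simpa using h2)
  have h := hP.coeff_mul_choose 1 ((minpoly k x).natDegree - 1) one_pos (by omega)
  rw [show 1 + ((minpoly k x).natDegree - 1) = (minpoly k x).natDegree by omega,
    hm.coeff_natDegree, one_mul, Nat.choose_one_right] at h
  rw [finrank_adjoin_singleton_eq_natDegree]
  exact (CharP.cast_eq_zero_iff k p _).mp h

variable [IsAlgClosed k] {ι : Type*} {Ci : ι → Subcoalgebra k H}

theorem exists_isHopfModule_and_dvd (hx : IsPrimitiveElement k x) (hCi : ∀ i, (Ci i).IsSimple)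
    (hxC : ∀ c ∈ ⨆ i, (Ci i).toSubmodule, x * c ∈ ⨆ i, (Ci i).toSubmodule)
    {M : Type*} [AddCommGroup M] [Module k M] {ρ : RightComodule k H M} (h : ρ.IsIrreducible)
    (hρ : ρ.coeffSpan ≤ ⨆ i, (Ci i).toSubmodule) :
    (∃ act : Algebra.adjoin k {x} →ₐ[k] Module.End k M,
      IsHopfModule hx.isSubbialgebra_adjoin act ρ) ∧
      Module.finrank k (Algebra.adjoin k {x}) ∣ Module.finrank k M := by
  have := h.finiteDimensional
  obtain ⟨A, hA0, hA⟩ := h.exists_aeval_eq_zero hx fun c hc =>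
    hx.mul_mem_of_isSubcoalgebra hCi hxC ρ.isSubcoalgebra_coeffSpan hρ hc
  obtain ⟨act, hact⟩ := exists_algHom_adjoin_singleton x A hA0
  refine ⟨⟨act, isHopfModule_of_primitive hx act ρ (hact ▸ hA)⟩, ?_⟩
  rw [finrank_adjoin_singleton_eq_natDegree]
  exact ρ.natDegree_minpoly_dvd_finrank hx hA0 hA

theorem finrank_adjoin_sq_dvd (hx : IsPrimitiveElement k x) (hCi : ∀ i, (Ci i).IsSimple)
    (hxC : ∀ c ∈ ⨆ i, (Ci i).toSubmodule, x * c ∈ ⨆ i, (Ci i).toSubmodule) (i : ι) :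
    Module.finrank k (Algebra.adjoin k {x}) ^ 2 ∣ Module.finrank k (Ci i) := by
  obtain ⟨N, σ, hσ, hspan⟩ := RightComodule.exists_isIrreducible_coeffSpan_eq (hCi i)
  have h1 := hσ.finrank_coeffSpan
  rw [hspan] at h1
  have h2 := (hx.exists_isHopfModule_and_dvd hCi hxC hσ
    (hspan.le.trans (le_iSup (fun i => (Ci i).toSubmodule) i))).2
  exact (pow_dvd_pow_of_dvd h2 2).trans (dvd_of_eq h1.symm)

/-- The source of the contradiction in the freeness statement, where it is applied to a primitive
element other than the given one. -/
theorem dvd_finrank_of_mul_mem (hx : IsPrimitiveElement k x) (hx0 : x ≠ 0) (p : ℕ) [CharP k p]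
    {C : Subcoalgebra k H} (hC : C.IsSimple) (hxC : ∀ c ∈ C.toSubmodule, x * c ∈ C.toSubmodule) :
    p ∣ Module.finrank k C := by
  have h := hx.finrank_adjoin_sq_dvd (Ci := fun _ : Unit => C) (fun _ => hC)
    (by simpa [iSup_const] using hxC) ()
  exact ((hx.dvd_finrank_adjoin hx0 p).trans (dvd_pow_self _ two_ne_zero)).trans h

end IsPrimitiveElement

end Divisibility

/-! ### The sums of the subspaces `xⁱ C` -/

section PowerSpan

variable {k : Type*} [Field k] {H : Type*} [Ring H]

section Bialgebra

variable [Bialgebra k H] {x : H}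

theorem IsPrimitiveElement.comul_pow_mul (hx : IsPrimitiveElement k x) (n : ℕ) (c : H) :
    Coalgebra.comul (R := k) (x ^ n * c) =
      ∑ m ∈ Finset.range (n + 1), (n.choose m : k) •
        TensorProduct.map (LinearMap.mulLeft k (x ^ m)) (LinearMap.mulLeft k (x ^ (n - m)))
          (Coalgebra.comul c) := by
  have h1 : Coalgebra.comul (R := k) (x ^ n * c) =
      (tensorSum (LinearMap.mulLeft k x) (LinearMap.mulLeft k x) ^ n) (Coalgebra.comul c) := by
    induction n with
    | zero => simp
    | succ n ih => rw [pow_succ', mul_assoc, hx.comul_mul, ih, pow_succ', Module.End.mul_apply]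
  rw [h1, tensorSum_pow, LinearMap.sum_apply]
  simp only [LinearMap.smul_apply, LinearMap.pow_mulLeft]

variable (k x) in
/-- The subspace `∑_{i < m} xⁱ C`. -/
def powSpan (C : Submodule k H) (m : ℕ) : Submodule k H :=
  ⨆ i : Fin m, C.map (LinearMap.mulLeft k (x ^ (i : ℕ)))

theorem pow_mul_mem_powSpan {C : Submodule k H} {m i : ℕ} (hi : i < m) {c : H} (hc : c ∈ C) :
    x ^ i * c ∈ powSpan k x C m :=
  (le_iSup (fun i : Fin m => C.map (LinearMap.mulLeft k (x ^ (i : ℕ)))) ⟨i, hi⟩) ⟨c, hc, rfl⟩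

theorem sliceRight_comul_pow_mul (hx : IsPrimitiveElement k x) (f : H →ₗ[k] k) (n : ℕ) (c : H) :
    sliceRight f (Coalgebra.comul (R := k) (x ^ n * c)) =
      ∑ m ∈ Finset.range (n + 1), (n.choose m : k) • (x ^ m *
        sliceRight (f ∘ₗ LinearMap.mulLeft k (x ^ (n - m))) (Coalgebra.comul (R := k) c)) := by
  simp [hx.comul_pow_mul, sliceRight_map]

theorem sliceLeft_comul_pow_mul (hx : IsPrimitiveElement k x) (f : H →ₗ[k] k) (n : ℕ) (c : H) :
    sliceLeft f (Coalgebra.comul (R := k) (x ^ n * c)) =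
      ∑ m ∈ Finset.range (n + 1), (n.choose m : k) • (x ^ (n - m) *
        sliceLeft (f ∘ₗ LinearMap.mulLeft k (x ^ m)) (Coalgebra.comul (R := k) c)) := by
  simp [hx.comul_pow_mul, sliceLeft_map]

theorem isSubcoalgebra_powSpan (hx : IsPrimitiveElement k x) {C : Submodule k H}
    (hC : IsSubcoalgebra C) (m : ℕ) : IsSubcoalgebra (powSpan k x C m) := by
  rw [isSubcoalgebra_iff] at *
  intro z hz
  induction hz using Submodule.iSup_induction' with
  | zero => simp
  | add a b _ _ ha hb =>
    simp only [map_add]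
    exact ⟨fun f => add_mem (ha.1 f) (hb.1 f), fun f => add_mem (ha.2 f) (hb.2 f)⟩
  | mem i z hz =>
    obtain ⟨c, hc, rfl⟩ := hz
    rw [LinearMap.mulLeft_apply]
    refine ⟨fun f => ?_, fun f => ?_⟩
    · rw [sliceRight_comul_pow_mul hx]
      refine Submodule.sum_mem _ fun j hj => Submodule.smul_mem _ _ (pow_mul_mem_powSpan ?_
        ((hC c hc).1 _))
      have := Finset.mem_range.mp hj
      omega
    · rw [sliceLeft_comul_pow_mul hx]
      refine Submodule.sum_mem _ fun j hj => Submodule.smul_mem _ _ (pow_mul_mem_powSpan ?_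
        ((hC c hc).2 _))
      have := Finset.mem_range.mp hj
      omega

/-- The elements `c` of `C` with `xᵐ c ∈ ∑_{i < m} xⁱ C` form a subcoalgebra. -/
theorem isSubcoalgebra_pow_mul_mem_powSpan (hx : IsPrimitiveElement k x) {C : Submodule k H}
    (hC : IsSubcoalgebra C) {m : ℕ} (hm : 0 < m) :
    IsSubcoalgebra (C ⊓ (powSpan k x C m).comap (LinearMap.mulLeft k (x ^ m))) := by
  have hF := isSubcoalgebra_iff.mp (isSubcoalgebra_powSpan hx hC m)
  rw [isSubcoalgebra_iff] at *
  rintro c ⟨hc, hxc⟩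
  rw [SetLike.mem_coe, Submodule.mem_comap, LinearMap.mulLeft_apply] at hxc
  refine ⟨fun f => ⟨(hC c hc).1 f, ?_⟩, fun f => ⟨(hC c hc).2 f, ?_⟩⟩
  · have h1 := (hF _ hxc).1 f
    -- Only the top term carries `x ^ m`; all others already lie in `powSpan`. For the left
    -- contraction the same role is played by the term of index `0`.
    rw [sliceRight_comul_pow_mul hx, Finset.sum_range_succ, Submodule.add_mem_iff_right] at h1
    · simpa [LinearMap.comp_id, Module.End.one_eq_id] using h1
    · exact Submodule.sum_mem _ fun j hj => Submodule.smul_mem _ _ (pow_mul_mem_powSpan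
        (Finset.mem_range.mp hj) ((hC c hc).1 _))
  · have h1 := (hF _ hxc).2 f
    rw [sliceLeft_comul_pow_mul hx, Finset.sum_range_succ', Submodule.add_mem_iff_right] at h1
    · simpa [LinearMap.comp_id, Module.End.one_eq_id] using h1
    · exact Submodule.sum_mem _ fun j hj => Submodule.smul_mem _ _ (pow_mul_mem_powSpan
        (by omega) ((hC c hc).2 _))

end Bialgebra

end PowerSpan

/-! ### Schur's lemma for simple subcoalgebras -/

section BicomoduleEndomorphisms

variable {k : Type*} [Field k] {H : Type*} [AddCommGroup H] [Module k H] [Coalgebra k H]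

theorem Subcoalgebra.comul_coe (C : Subcoalgebra k H) (c : C) :
    Coalgebra.comul (R := k) (C.subtype c) =
      TensorProduct.map C.subtype C.subtype (Coalgebra.comul (R := k) c) :=
  (LinearMap.congr_fun C.map_comp_comul c).symm

/-- Endomorphisms of a simple subcoalgebra as a bicomodule over itself are scalar. -/
theorem Subcoalgebra.IsSimple.exists_eq_smul [IsAlgClosed k] [FiniteDimensional k H]
    {C : Subcoalgebra k H} (hC : C.IsSimple) {θ : Module.End k C}
    (h1 : ∀ c, θ.rTensor C (Coalgebra.comul (R := k) c) = Coalgebra.comul (R := k) (θ c))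
    (h2 : ∀ c, θ.lTensor C (Coalgebra.comul (R := k) c) = Coalgebra.comul (R := k) (θ c)) :
    ∃ a : k, ∀ c, θ c = a • c := by
  have : FiniteDimensional k C := inferInstanceAs (FiniteDimensional k C.toSubmodule)
  have : Nontrivial C := Submodule.nontrivial_iff_ne_bot.mpr hC.1
  obtain ⟨a, ha⟩ := Module.End.exists_eigenvalue θ
  -- An eigenspace of a bicomodule endomorphism is a subcoalgebra.
  have hU : IsSubcoalgebra ((θ.eigenspace a).map C.subtype) := by
    rw [isSubcoalgebra_iff]
    rintro _ ⟨c, hc, rfl⟩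
    rw [SetLike.mem_coe, Module.End.mem_eigenspace_iff] at hc
    rw [C.comul_coe]
    refine ⟨fun f => ?_, fun f => ?_⟩
    · rw [sliceRight_map]
      refine ⟨_, ?_, rfl⟩
      rw [SetLike.mem_coe, Module.End.mem_eigenspace_iff, ← map_smul, ← map_smul, ← hc, ← h1,
        LinearMap.rTensor, sliceRight_map, LinearMap.comp_id]
    · rw [sliceLeft_map]
      refine ⟨_, ?_, rfl⟩
      rw [SetLike.mem_coe, Module.End.mem_eigenspace_iff, ← map_smul, ← map_smul, ← hc, ← h2,
        LinearMap.lTensor, sliceLeft_map, LinearMap.comp_id]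
  refine ⟨a, fun c => ?_⟩
  rcases hC.2 ⟨_, hU⟩ (by rintro _ ⟨c, -, rfl⟩; exact c.2) with h | h
  · exact absurd (Submodule.map_injective_of_injective C.subtype_injective
      (h.trans (Submodule.map_bot _).symm)) ha
  · obtain ⟨c', hc', he⟩ := h.ge c.2
    rw [← Module.End.mem_eigenspace_iff, ← C.subtype_injective he]
    exact hc'

end BicomoduleEndomorphisms

/-! ### Freeness of `k[x] C` -/

section FreeOverPrimitive

variable {k : Type*} [Field k] {H : Type*} [Ring H]

section Bialgebra

variable [Bialgebra k H] {x : H}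

variable (x) in
/-- The map `(c_i) ↦ ∑_{i < m} xⁱ c_i`. -/
def powSum (C : Subcoalgebra k H) (m : ℕ) : (Fin m → C) →ₗ[k] H :=
  ∑ i : Fin m, LinearMap.mulLeft k (x ^ (i : ℕ)) ∘ₗ C.subtype ∘ₗ LinearMap.proj i

theorem powSum_apply (C : Subcoalgebra k H) (m : ℕ) (c : Fin m → C) :
    powSum x C m c = ∑ i : Fin m, x ^ (i : ℕ) * C.subtype (c i) := by
  simp [powSum, LinearMap.sum_apply]

theorem exists_powSpan_coord {C : Subcoalgebra k H} {m : ℕ}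
    (hinj : Function.Injective (powSum x C m)) :
    ∃ π : ℕ → H →ₗ[k] C, (∀ a, ∀ i < m, ∀ c : C,
        π a (x ^ i * C.subtype c) = if i = a then c else 0) ∧
      ∀ z ∈ powSpan k x C.toSubmodule m,
        z = ∑ i ∈ Finset.range m, x ^ i * C.subtype (π i z) := by
  obtain ⟨G, hG⟩ := (powSum x C m).exists_leftInverse_of_injective (LinearMap.ker_eq_bot.mpr hinj)
  -- Coordinates of index at least `m` are `0` by convention, in agreement with the stated formula.
  let π : ℕ → H →ₗ[k] C := fun a => if h : a < m then LinearMap.proj ⟨a, h⟩ ∘ₗ G else 0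
  have h1 : ∀ a, ∀ i < m, ∀ c : C, π a (x ^ i * C.subtype c) = if i = a then c else 0 := by
    intro a i hi c
    have h2 := LinearMap.congr_fun hG (Pi.single ⟨i, hi⟩ c)
    rw [LinearMap.comp_apply, powSum_apply, Finset.sum_eq_single ⟨i, hi⟩, Pi.single_eq_same,
      LinearMap.id_apply] at h2
    · by_cases ha : a < m
      · simp only [π, ha, dif_pos, LinearMap.comp_apply, h2]
        simp [Pi.single_apply, eq_comm]
      · rw [if_neg (by omega)]
        simp [π, ha]
    · intro j _ hj
      rw [Pi.single_eq_of_ne hj, map_zero, mul_zero]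
    · simp
  refine ⟨π, h1, fun z hz => ?_⟩
  induction hz using Submodule.iSup_induction' with
  | zero => simp
  | add a b _ _ ha hb =>
    nth_rewrite 1 [ha, hb]
    simp only [map_add, mul_add, Finset.sum_add_distrib]
  | mem i z hz =>
    obtain ⟨c, hc, rfl⟩ := hz
    have h2 : ∀ a, π a (x ^ (i : ℕ) * c) = if (i : ℕ) = a then ⟨c, hc⟩ else 0 :=
      fun a => h1 a i i.2 ⟨c, hc⟩
    rw [LinearMap.mulLeft_apply, Finset.sum_eq_single_of_mem (i : ℕ) (Finset.mem_range.mpr i.2)]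
    · rw [h2, if_pos rfl]
      rfl
    · intro j _ hj
      rw [h2, if_neg hj.symm, map_zero, mul_zero]

theorem map_comul_pow_mul (hx : IsPrimitiveElement k x) {C : Subcoalgebra k H} {V W : Type*}
    [AddCommGroup V] [Module k V] [AddCommGroup W] [Module k W] (α : H →ₗ[k] V) (β : H →ₗ[k] W)
    (n : ℕ) (c : C) :
    TensorProduct.map α β (Coalgebra.comul (R := k) (x ^ n * C.subtype c)) =
      ∑ j ∈ Finset.range (n + 1), (n.choose j : k) •
        TensorProduct.map (α ∘ₗ LinearMap.mulLeft k (x ^ j) ∘ₗ C.subtype)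
          (β ∘ₗ LinearMap.mulLeft k (x ^ (n - j)) ∘ₗ C.subtype) (Coalgebra.comul (R := k) c) := by
  simp only [hx.comul_pow_mul, C.comul_coe, map_sum, map_smul, TensorProduct.map_comp,
    LinearMap.comp_apply]

/-- The comparison of coefficients in the comultiplication of a relation
`xᵐ c = ∑_{i < m} xⁱ θᵢ(c)`. -/
theorem coeff_comul_relation (hx : IsPrimitiveElement k x) {C : Subcoalgebra k H} {m : ℕ}
    (hm : 0 < m) {π : ℕ → H →ₗ[k] C}
    (hπ : ∀ a, ∀ i < m, ∀ c : C, π a (x ^ i * C.subtype c) = if i = a then c else 0)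
    {θ : ℕ → Module.End k C} (hθ : ∀ a c, π a (x ^ m * C.subtype c) = θ a c)
    (hrel : ∀ c, x ^ m * C.subtype c = ∑ i ∈ Finset.range m, x ^ i * C.subtype (θ i c))
    (a b : ℕ) (c : C) :
    (if b = 0 then (θ a).rTensor C (Coalgebra.comul (R := k) c) else 0) +
      (if a = 0 then (θ b).lTensor C (Coalgebra.comul (R := k) c) else 0) +
      (if 0 < a ∧ 0 < b ∧ a + b = m then (m.choose a : k) • Coalgebra.comul (R := k) c else 0) =
    if a + b < m then ((a + b).choose a : k) • Coalgebra.comul (R := k) (θ (a + b) c) else 0 := by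
  have hτ : ∀ a, ∀ i < m, π a ∘ₗ LinearMap.mulLeft k (x ^ i) ∘ₗ C.subtype =
      if i = a then LinearMap.id else 0 := by
    intro a i hi
    ext c : 1
    refine (hπ a i hi c).trans ?_
    split_ifs <;> rfl
  have hτm : ∀ a, π a ∘ₗ LinearMap.mulLeft k (x ^ m) ∘ₗ C.subtype = θ a := by
    intro a
    ext c : 1
    exact hθ a c
  have hterm : ∀ n j, j < m → n - j < m → ∀ c : C,
      TensorProduct.map (π a ∘ₗ LinearMap.mulLeft k (x ^ j) ∘ₗ C.subtype)
        (π b ∘ₗ LinearMap.mulLeft k (x ^ (n - j)) ∘ₗ C.subtype) (Coalgebra.comul (R := k) c) =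
      if j = a ∧ n - j = b then Coalgebra.comul (R := k) c else 0 := by
    intro n j hj hnj c
    rw [hτ a j hj, hτ b _ hnj]
    by_cases h1 : j = a
    · by_cases h2 : n - j = b
      · rw [if_pos h1, if_pos h2, if_pos ⟨h1, h2⟩, TensorProduct.map_id, LinearMap.id_apply]
      · rw [if_neg h2, if_neg (c := j = a ∧ n - j = b) (fun h => h2 h.2),
          TensorProduct.map_zero_right, LinearMap.zero_apply]
    · rw [if_neg h1, if_neg (c := j = a ∧ n - j = b) (fun h => h1 h.1),
        TensorProduct.map_zero_left, LinearMap.zero_apply]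
  have hlt : ∀ n < m, ∀ c : C,
      TensorProduct.map (π a) (π b) (Coalgebra.comul (R := k) (x ^ n * C.subtype c)) =
        if n = a + b then (n.choose a : k) • Coalgebra.comul (R := k) c else 0 := by
    intro n hn c
    rw [map_comul_pow_mul hx, Finset.sum_congr rfl fun j hj => by
      rw [hterm n j (by have := Finset.mem_range.mp hj; omega) (by omega) c]]
    split_ifs with h
    · rw [Finset.sum_eq_single_of_mem a (Finset.mem_range.mpr (by omega))]
      · rw [if_pos ⟨rfl, by omega⟩]
      · intro j _ hj
        rw [if_neg (fun h => hj h.1), smul_zero]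
    · refine Finset.sum_eq_zero fun j hj => ?_
      have := Finset.mem_range.mp hj
      rw [if_neg (by omega), smul_zero]
  have hR : TensorProduct.map (π a) (π b) (Coalgebra.comul (R := k) (x ^ m * C.subtype c)) =
      if a + b < m then ((a + b).choose a : k) • Coalgebra.comul (R := k) (θ (a + b) c) else 0 := by
    rw [hrel, map_sum, map_sum, Finset.sum_congr rfl fun i hi => hlt i (Finset.mem_range.mp hi) _]
    split_ifs with h
    · rw [Finset.sum_eq_single_of_mem (a + b) (Finset.mem_range.mpr h), if_pos rfl]
      intro j _ hj
      rw [if_neg hj]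
    · refine Finset.sum_eq_zero fun j hj => ?_
      have := Finset.mem_range.mp hj
      rw [if_neg (by omega)]
  -- The map `π a ⊗ π b` is applied to `Δ` of both sides of the relation. On the left the terms with
  -- `x ^ m` in one tensor factor bring in `θ`, and the intermediate ones contribute a binomial
  -- coefficient.
  rw [← hR, map_comul_pow_mul hx]
  obtain ⟨m, rfl⟩ := Nat.exists_eq_succ_of_ne_zero hm.ne'
  rw [Finset.sum_range_succ, Finset.sum_range_succ', Finset.sum_congr rfl fun j hj => by
    rw [hterm (m + 1) (j + 1) (by have := Finset.mem_range.mp hj; omega) (by omega) c]]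
  have e1 : ((m + 1).choose (m + 1) : k) •
      TensorProduct.map (π a ∘ₗ LinearMap.mulLeft k (x ^ (m + 1)) ∘ₗ C.subtype)
        (π b ∘ₗ LinearMap.mulLeft k (x ^ (m + 1 - (m + 1))) ∘ₗ C.subtype)
        (Coalgebra.comul (R := k) c) =
      if b = 0 then (θ a).rTensor C (Coalgebra.comul (R := k) c) else 0 := by
    rw [hτm, Nat.sub_self, hτ b 0 hm, Nat.choose_self, Nat.cast_one, one_smul]
    by_cases h : b = 0
    · simp [h, LinearMap.rTensor]
    · simp [h, Ne.symm h]
  have e2 : ((m + 1).choose 0 : k) •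
      TensorProduct.map (π a ∘ₗ LinearMap.mulLeft k (x ^ 0) ∘ₗ C.subtype)
        (π b ∘ₗ LinearMap.mulLeft k (x ^ (m + 1 - 0)) ∘ₗ C.subtype)
        (Coalgebra.comul (R := k) c) =
      if a = 0 then (θ b).lTensor C (Coalgebra.comul (R := k) c) else 0 := by
    rw [Nat.sub_zero, hτm, hτ a 0 hm, Nat.choose_zero_right, Nat.cast_one, one_smul]
    by_cases h : a = 0
    · simp [h, LinearMap.lTensor]
    · simp [h, Ne.symm h]
  have e3 : ∑ j ∈ Finset.range m, ((m + 1).choose (j + 1) : k) •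
      (if j + 1 = a ∧ m + 1 - (j + 1) = b then Coalgebra.comul (R := k) c else 0) =
      if 0 < a ∧ 0 < b ∧ a + b = m + 1 then
        ((m + 1).choose a : k) • Coalgebra.comul (R := k) c else 0 := by
    split_ifs with h
    · rw [Finset.sum_eq_single_of_mem (a - 1) (Finset.mem_range.mpr (by omega))]
      · rw [if_pos ⟨by omega, by omega⟩, Nat.sub_add_cancel h.1]
      · intro j _ hj
        rw [if_neg (by omega), smul_zero]
    · refine Finset.sum_eq_zero fun j hj => ?_
      have := Finset.mem_range.mp hj
      rw [if_neg (by omega), smul_zero]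
  rw [e1, e2, e3]
  abel

end Bialgebra

variable [HopfAlgebra k H] [FiniteDimensional k H] [IsAlgClosed k] {x : H}

/-- Otherwise simplicity gives a relation for `xᵐ c` on all of `C`. Its coefficients of positive
index are scalars and assemble into a nonzero primitive element preserving `C`, which contradicts `¬
p ∣ dim C`. -/
theorem IsPrimitiveElement.eq_zero_of_pow_mul_mem_powSpan (hx : IsPrimitiveElement k x) (p : ℕ)
    [CharP k p] {C : Subcoalgebra k H} (hC : C.IsSimple) (hp : ¬ p ∣ Module.finrank k C) {m : ℕ}
    (hm : 0 < m) (hmd : m < (minpoly k x).natDegree)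
    (hinj : Function.Injective (powSum x C m)) {c : H} (hc : c ∈ C.toSubmodule)
    (hxc : x ^ m * c ∈ powSpan k x C.toSubmodule m) : c = 0 := by
  have hV := isSubcoalgebra_pow_mul_mem_powSpan hx C.isSubcoalgebra hm
  rcases hC.2 ⟨_, hV⟩ inf_le_left with h | h
  · exact (Submodule.mem_bot k).mp (h.le ⟨hc, hxc⟩)
  exfalso
  obtain ⟨π, hπ, hπ'⟩ := exists_powSpan_coord hinj
  let θ : ℕ → Module.End k C := fun a => π a ∘ₗ LinearMap.mulLeft k (x ^ m) ∘ₗ C.subtype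
  have hrel : ∀ c, x ^ m * C.subtype c = ∑ i ∈ Finset.range m, x ^ i * C.subtype (θ i c) :=
    fun c => hπ' _ (h.ge c.2).2
  have key := coeff_comul_relation hx hm hπ (θ := θ) (fun _ _ => rfl) hrel
  have hscalar : ∀ a, 0 < a → a < m → ∃ l : k, ∀ c, θ a c = l • c := by
    intro a ha ham
    refine hC.exists_eq_smul (fun c => ?_) fun c => ?_
    · have := key a 0 c
      simpa [ha.ne', ham] using this
    · have := key 0 a c
      simpa [ha.ne', ham] using this
  choose! l hl using hscalar
  obtain ⟨c₀, hc₀C, hc₀⟩ := (Submodule.ne_bot_iff _).mp hC.1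
  have hΔ : ∀ s : k, s • Coalgebra.comul (R := k) (⟨c₀, hc₀C⟩ : C) = 0 → s = 0 := by
    intro s hs
    refine (smul_eq_zero.mp hs).resolve_right fun h0 => hc₀ ?_
    exact congrArg C.subtype (comul_eq_zero (k := k) h0)
  -- The coefficients of `Xᵐ - ∑ lₙ Xⁿ` over `0 < n < m`. The constant term is `0`: `θ 0` need not
  -- be a scalar and stays on the other side of the relation.
  let r : ℕ → k := fun n => if n = m then 1 else if 0 < n then -l n else 0
  let R : k[X] := ∑ n ∈ Finset.range (m + 1), Polynomial.C (r n) * X ^ n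
  have hcoeff : ∀ n, R.coeff n = if n < m + 1 then r n else 0 := by
    intro n
    simp [R, finsetSum_coeff, coeff_C_mul, coeff_X_pow]
  have hR : R.IsAdditive := by
    constructor
    · rw [hcoeff]
      simp [r, hm.ne]
    · intro i j hi hj
      rw [hcoeff]
      have h1 := key i j ⟨c₀, hc₀C⟩
      rw [if_neg hj.ne', if_neg hi.ne', zero_add, zero_add] at h1
      rcases lt_trichotomy (i + j) m with h2 | h2 | h2
      · rw [if_neg (by omega), if_pos h2, hl _ (by omega) h2, map_smul, smul_smul] at h1
        have h3 := hΔ _ h1.symm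
        rw [if_pos (by omega)]
        simp only [r]
        rw [if_neg h2.ne, if_pos (by omega), neg_mul, mul_comm, h3, neg_zero]
      · rw [if_pos ⟨hi, hj, h2⟩, if_neg (by omega)] at h1
        rw [h2, hΔ _ h1, mul_zero]
      · rw [if_neg (by omega), zero_mul]
  have hR0 : R ≠ 0 := by
    intro h0
    have := hcoeff m
    rw [h0, if_pos (by omega)] at this
    simp [r] at this
  have hy0 : aeval x R ≠ 0 := by
    intro h0
    have h1 := natDegree_le_of_dvd (minpoly.dvd k x h0) hR0
    have h2 : R.natDegree ≤ m := by
      rw [natDegree_le_iff_coeff_eq_zero]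
      intro n hn
      rw [hcoeff, if_neg (by omega)]
    omega
  refine hp ((hx.aeval_of_isAdditive hR).dvd_finrank_of_mul_mem hy0 p hC fun c hc => ?_)
  -- The scalar terms cancel in the relation and only `θ 0`, which maps `C` to itself, remains.
  have h1 : aeval x R * c = C.subtype (θ 0 ⟨c, hc⟩) := by
    have h2 : aeval x R = ∑ n ∈ Finset.range (m + 1), r n • x ^ n := by
      simp [R, Algebra.smul_def]
    have h3 := hrel ⟨c, hc⟩
    change x ^ m * c = _ at h3
    obtain ⟨m, rfl⟩ := Nat.exists_eq_succ_of_ne_zero hm.ne'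
    rw [h2, Finset.sum_range_succ, add_mul, Finset.sum_mul]
    have h4 : r (m + 1) = 1 := if_pos rfl
    rw [h4, one_smul, h3, ← Finset.sum_add_distrib, Finset.sum_range_succ',
      Finset.sum_eq_zero, zero_add]
    · simp [r]
    · intro j hj
      have hj' := Finset.mem_range.mp hj
      have h5 : r (j + 1) = -l (j + 1) := by
        simp only [r]
        rw [if_neg (by omega), if_pos (by omega)]
      rw [h5, hl _ (by omega) (by omega), map_smul, neg_smul, neg_mul, smul_mul_assoc,
        mul_smul_comm]
      exact neg_add_cancel _
  rw [h1]
  exact (θ 0 ⟨c, hc⟩).2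

theorem IsPrimitiveElement.powSum_injective (hx : IsPrimitiveElement k x) (p : ℕ)
    [CharP k p] {C : Subcoalgebra k H} (hC : C.IsSimple) (hp : ¬ p ∣ Module.finrank k C) {m : ℕ}
    (hm : m ≤ (minpoly k x).natDegree) : Function.Injective (powSum x C m) := by
  induction m with
  | zero => exact Function.injective_of_subsingleton _
  | succ m ih =>
    have hinj := ih (by omega)
    rw [← LinearMap.ker_eq_bot, LinearMap.ker_eq_bot']
    intro c hc
    have hc' := hc
    rw [powSum_apply, Fin.sum_univ_castSucc] at hc
    have hlast : c (Fin.last m) = 0 := by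
      apply C.subtype_injective
      rw [map_zero]
      rcases Nat.eq_zero_or_pos m with rfl | hm0
      · simpa using hc
      · refine hx.eq_zero_of_pow_mul_mem_powSpan p hC hp hm0 (by omega) hinj
          (c (Fin.last m)).2 ?_
        have h1 := eq_neg_of_add_eq_zero_right hc
        change x ^ m * C.subtype (c (Fin.last m)) ∈ _
        rw [Fin.val_last] at h1
        rw [h1]
        exact neg_mem (Submodule.sum_mem _ fun i _ => pow_mul_mem_powSpan i.2 (c i.castSucc).2)
    rw [hlast, map_zero, mul_zero, add_zero] at hc
    have h2 : (fun i => c (Fin.castSucc i)) = 0 := hinj (by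
      rw [powSum_apply, map_zero]
      exact hc)
    ext i
    refine Fin.lastCases ?_ (fun i => ?_) i
    · rw [hlast]; rfl
    · rw [show c i.castSucc = 0 from congrFun h2 i]; rfl

/-- A `k`-basis of `C` is a `k[x]`-basis of the span: a `k[x]`-relation, with coefficients written
as polynomials of degree below that of the minimal polynomial and regrouped by powers of `x`, is an
element of the kernel of `powSum`. -/
theorem IsPrimitiveElement.nonempty_basis_span (hx : IsPrimitiveElement k x) (p : ℕ)
    [CharP k p] {C : Subcoalgebra k H} (hC : C.IsSimple) (hp : ¬ p ∣ Module.finrank k C) :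
    Nonempty (Module.Basis (Fin (Module.finrank k C)) (Algebra.adjoin k {x})
      (Submodule.span (Algebra.adjoin k {x}) (C : Set H))) := by
  have : FiniteDimensional k C := inferInstanceAs (FiniteDimensional k C.toSubmodule)
  have hint : IsIntegral k x := Algebra.IsIntegral.isIntegral x
  have : Nontrivial H := by
    obtain ⟨c, -, hc⟩ := (Submodule.ne_bot_iff _).mp hC.1
    exact nontrivial_of_ne c 0 hc
  let b := Module.finBasis k C
  let v : Fin (Module.finrank k C) → H := fun j => C.subtype (b j)
  have hv : LinearIndependent (Algebra.adjoin k {x}) v := by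
    rw [Fintype.linearIndependent_iff]
    intro u hu
    have hpoly : ∀ j, ∃ q : k[X], q.natDegree < (minpoly k x).natDegree ∧
        aeval x q = (u j : H) := by
      intro j
      obtain ⟨q, hq⟩ := (Algebra.adjoin_singleton_eq_range_aeval k x).le (u j).2
      refine ⟨q %ₘ minpoly k x, natDegree_modByMonic_lt _ (minpoly.monic hint) ?_, ?_⟩
      · intro h
        have := minpoly.natDegree_pos hint
        rw [h, natDegree_one] at this
        exact this.false
      · have h1 := congrArg (aeval x) (modByMonic_add_div q (minpoly k x))
        rw [map_add, map_mul, minpoly.aeval, zero_mul, add_zero] at h1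
        exact h1.trans hq
    choose q hq hqu using hpoly
    let a : Fin (minpoly k x).natDegree → C := fun i => ∑ j, (q j).coeff i • b j
    have ha : powSum x C _ a = 0 := by
      rw [powSum_apply, ← hu]
      simp only [a, map_sum, Finset.mul_sum, map_smul]
      rw [Finset.sum_comm]
      refine Finset.sum_congr rfl fun j _ => ?_
      rw [Subalgebra.smul_def, smul_eq_mul, ← hqu, aeval_eq_sum_range' (hq j), Finset.sum_range,
        Finset.sum_mul]
      refine Finset.sum_congr rfl fun i _ => ?_
      rw [mul_smul_comm, smul_mul_assoc]
    have ha0 := (map_eq_zero_iff _ (hx.powSum_injective p hC hp le_rfl)).mp ha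
    intro j
    apply Subtype.ext
    have hq0 : q j = 0 := by
      ext i
      rcases lt_or_ge i (minpoly k x).natDegree with hi | hi
      · exact Fintype.linearIndependent_iff.mp b.linearIndependent (fun j => (q j).coeff i)
          (congrFun ha0 ⟨i, hi⟩) j
      · rw [coeff_eq_zero_of_natDegree_lt ((hq j).trans_le hi), coeff_zero]
    rw [← hqu, hq0, map_zero]
    rfl
  have hspan : Submodule.span (Algebra.adjoin k {x}) (Set.range v) =
      Submodule.span (Algebra.adjoin k {x}) (C : Set H) := by
    apply le_antisymm
    · refine Submodule.span_mono ?_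
      rintro _ ⟨j, rfl⟩
      exact (b j).2
    · rw [Submodule.span_le]
      intro c hc
      have h1 := congrArg C.subtype (b.sum_repr ⟨c, hc⟩)
      rw [map_sum] at h1
      change _ = c at h1
      rw [← h1]
      refine Submodule.sum_mem _ fun j _ => ?_
      rw [map_smul, ← algebraMap_smul (Algebra.adjoin k {x})]
      exact Submodule.smul_mem _ _ (Submodule.subset_span ⟨j, rfl⟩)
  rw [← hspan]
  exact ⟨Module.Basis.span hv⟩

end FreeOverPrimitive

theorem propositionp {k : Type*} [Field k] [IsAlgClosed k] {p : ℕ} [Fact p.Prime] [CharP k p]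
    {H : Type*} [Ring H] [HopfAlgebra k H] [FiniteDimensional k H]
    (x : H) (hx0 : x ≠ 0) (hx : IsPrimitiveElement k x)
    {ι : Type*} (Ci : ι → Subcoalgebra k H) (hCi : ∀ i, (Ci i).IsSimple)
    (C : Subcoalgebra k H) (hC : C.toSubmodule = ⨆ i, (Ci i).toSubmodule) :
    ((∀ c ∈ C, x * c ∈ C) →
      (∀ (M : Type*) [AddCommGroup M] [Module k M] (ρ : RightComodule k C M), ρ.IsSimple →
        (∃ act : Algebra.adjoin k {x} →ₐ[k] Module.End k M,
          IsHopfModule hx.isSubbialgebra_adjoin act (ρ.push C.incl)) ∧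
        FiniteDimensional k M ∧
        Module.finrank k (Algebra.adjoin k {x}) ∣ Module.finrank k M) ∧
      (∀ i, Module.finrank k (Algebra.adjoin k {x}) ^ 2 ∣ Module.finrank k (Ci i))) ∧
    (C.IsSimple → ¬ p ∣ Module.finrank k C →
      Nonempty (Module.Basis (Fin (Module.finrank k C)) (Algebra.adjoin k {x})
        (Submodule.span (Algebra.adjoin k {x}) (C : Set H)))) := by
  refine ⟨fun hxC => ?_, fun hs hp => hx.nonempty_basis_span p hs hp⟩
  have hxC' : ∀ c ∈ ⨆ i, (Ci i).toSubmodule, x * c ∈ ⨆ i, (Ci i).toSubmodule :=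
    hC ▸ fun c hc => hxC c hc
  refine ⟨fun M _ _ ρ hρ => ?_, fun i => hx.finrank_adjoin_sq_dvd hCi hxC' i⟩
  have hirr := hρ.isIrreducible_push
  obtain ⟨h1, h2⟩ := hx.exists_isHopfModule_and_dvd hCi hxC' hirr
    (hC ▸ RightComodule.coeffSpan_push_le ρ)
  exact ⟨h1, hirr.finiteDimensional, h2⟩
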